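/- **Lemma.** There is an absolute constant $C>0$ such that the following holds. *Setting.* Let $1\le m<d$ be integers, $\mathcal D_0,\mathcal D_1$ probability distributions on $\mathbb R^d$ and $p\in[p_{\min},1-p_{\min}]$ with $p_{\min}\in(0,1/2]$. Samples are i.i.d. pairs $(a_i,x_i)$, $i\ge1$, with $a_i\sim\mathrm{Bernoulli}(p)$ and $x_i\mid a_i\sim\mathcal D_{a_i}$. Write $S_a=\mathbb E[xx^\intercal\mid a]$ and $S=S_1-S_0$, let $\nu_1\ge\dots\ge\nu_d\ge0$ be the singular values of $S$, and let the columns of $P_m\in\mathbb R^{d\times m}$ be orthonormal eigenvectors of $S$ for its $m$ eigenvalues of largest magnitude. Let $\|\cdot\|$ be the spectral norm, and let $\mathcal M,\mathcal V,\Delta_{m,\nu}>0$ be such that, for $a\in\{0,1\}$, $$\mathbb P\big[\|xx^\intercal-S_a\|\le\mathcal M\,\big|\,a\big]=1,\qquad \mathrm{Var}(xx^\intercal\mid a)\le\mathcal V,\qquad \nu_m-\nu_{m+1}\ge\Delta_{m,\nu},$$ where $\mathrm{Var}(X)=\max(\|\mathbb E[ZZ^\intercal]\|,\|\mathbb E[Z^\intercal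 Z]\|)$ with $Z=X-\mathbb E X$. *Algorithm 1 (with block size $b$).* $W_0=\mathrm{QR}(G)$, where $G\in\mathbb R^{d\times m}$ has independent standard Gaussian entries and is independent of the samples; for $t\ge1$, $W_t=\mathrm{QR}(C_t^{(1)}-C_t^{(0)})$, where $$C_t^{(a)}=\frac1{b_t^{(a)}}\sum_{i=(t-1)b+1}^{tb}\mathbf 1_{[a_i=a]}\,x_ix_i^\intercal W_{t-1},\qquad b_t^{(a)}=\sum_{i=(t-1)b+1}^{tb}\mathbf 1_{[a_i=a]},$$ and $C_t^{(a)}=0$ if $b_t^{(a)}=0$. Here $\mathrm{QR}$ is any measurable routine that returns for each $F\in\mathbb R^{d\times m}$ a matrix $Q\in\mathbb R^{d\times m}$ with $Q^\intercal Q=I_m$ and $F=QR$ for some upper triangular $R$. The noise matrices are $Z_{t,1}=(C_t^{(1)}-C_t^{(0)})-SW_{t-1}$. *Claim.* Let $\epsilon,\delta\in(0,1)$. If $$b\ \ge\ C\left[\frac{\mathcal V}{\Delta_{m,\nu}^2\,p_{\min}}\left(\frac{dm}{\delta^2}\max\Big\{\log\frac m\delta,\log2\Big\}+\frac1{\epsilon^2}\log\frac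 d\delta\right)+\frac{\max\{1,\mathcal M^2/\mathcal V\}}{p_{\min}}\log\frac d\delta\right],$$ then for every $t\ge1$, with probability at least $1-\delta$, $$5\|Z_{t,1}\|\le\epsilon\,\Delta_{m,\nu}\qquad\text{and}\qquad 5\|P_m^\intercal Z_{t,1}\|\le\frac{\delta\,\Delta_{m,\nu}}{2\sqrt{dm}}.$$ (If $\mathcal V\le\mathcal M^2$, and $m\ge2$ or $\delta\le1/2$, both maxima may be dropped: they equal $\mathcal M^2/\mathcal V$ and $\log(m/\delta)$.) -/

import Mathlib

open MeasureTheory ProbabilityTheory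
open scoped Matrix Matrix.Norms.L2Operator

/-! Matrices carry the spectral norm (the operator norm for the Euclidean norms): this is what
`‖A‖` means for a matrix `A` below. -/

noncomputable section

namespace FairPCA

/-- The rank-one matrix `x xᵀ`. -/
def outer {d : ℕ} (x : EuclideanSpace ℝ (Fin d)) : Matrix (Fin d) (Fin d) ℝ :=
  Matrix.of fun i j => x i * x j

/-- The entrywise expectation of a matrix-valued function. -/
def expect {d k l : ℕ} (D : Measure (EuclideanSpace ℝ (Fin d)))
    (F : EuclideanSpace ℝ (Fin d) → Matrix (Fin k) (Fin l) ℝ) : Matrix (Fin k) (Fin l) ℝ :=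
  Matrix.of fun i j => ∫ x, F x i j ∂D

/-- The second moment matrix `E[x xᵀ]` of `x ∼ D` (which equals `Σ + μ μᵀ` for the mean `μ` and the
covariance matrix `Σ` of `D`). -/
def secondMoment {d : ℕ} (D : Measure (EuclideanSpace ℝ (Fin d))) : Matrix (Fin d) (Fin d) ℝ :=
  expect D outer

/-- The scalar variance of the random matrix `x xᵀ`, `x ∼ D`: with `Z = x xᵀ - E[x xᵀ]`, it is
`max (‖E[Z Zᵀ]‖) (‖E[Zᵀ Z]‖)`. -/
def outerVariance {d : ℕ} (D : Measure (EuclideanSpace ℝ (Fin d))) : ℝ :=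
  max ‖expect D fun x => (outer x - secondMoment D) * (outer x - secondMoment D)ᵀ‖
    ‖expect D fun x => (outer x - secondMoment D)ᵀ * (outer x - secondMoment D)‖

/-- The second moment gap `S = E[x xᵀ | a = 1] - E[x xᵀ | a = 0]`. -/
def momentGap {d : ℕ} (D : Fin 2 → Measure (EuclideanSpace ℝ (Fin d))) :
    Matrix (Fin d) (Fin d) ℝ :=
  secondMoment (D 1) - secondMoment (D 0)

/-- The `j`-th largest singular value of `A`, counted from `j = 1`. -/
def singularValue {d : ℕ} (A : Matrix (Fin d) (Fin d) ℝ) (j : ℕ) : ℝ :=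
  (Matrix.toEuclideanLin A).singularValues (j - 1)

/-- The law of the pair `(a, x)` with `a ∼ Bernoulli(p)` and `x | a ∼ D a`. -/
def pairLaw {d : ℕ} (D : Fin 2 → Measure (EuclideanSpace ℝ (Fin d))) (p : ℝ) :
    Measure (Fin 2 × EuclideanSpace ℝ (Fin d)) :=
  ENNReal.ofReal (1 - p) • (Measure.dirac 0).prod (D 0) +
    ENNReal.ofReal p • (Measure.dirac 1).prod (D 1)

/-- The assumptions on the group-conditional laws `D 0`, `D 1` and on the mixture parameter `p`:
`𝓜` bounds the deviation of `x xᵀ` from its group mean, `𝓥` bounds its group variance, both groups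
have probability at least `pmin`, and the `m`-th singular value gap of `S` is at least `Δ`. -/
structure DataAssumption {d : ℕ} (m : ℕ) (D : Fin 2 → Measure (EuclideanSpace ℝ (Fin d)))
    (p 𝓜 𝓥 pmin Δ : ℝ) : Prop where
  isProb : ∀ a, IsProbabilityMeasure (D a)
  bounded : ∀ a, ∀ᵐ x ∂(D a), ‖outer x - secondMoment (D a)‖ ≤ 𝓜
  variance_le : ∀ a, outerVariance (D a) ≤ 𝓥
  p_mem : p ∈ Set.Icc pmin (1 - pmin)
  gap : Δ ≤ singularValue (momentGap D) m - singularValue (momentGap D) (m + 1)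

/-- The columns of `P` are orthonormal eigenvectors of `S` for its `m` eigenvalues of largest
magnitude (with multiplicity): every eigenvector of `S` that is orthogonal to all these columns
belongs to an eigenvalue of magnitude at most that of each of the `m` chosen ones. -/
def IsTopEigenvectors {d m : ℕ} (S : Matrix (Fin d) (Fin d) ℝ) (P : Matrix (Fin d) (Fin m) ℝ) :
    Prop :=
  Pᵀ * P = 1 ∧ ∃ ev : Fin m → ℝ, S * P = P * Matrix.diagonal ev ∧
    ∀ (r : ℝ) (v : Fin d → ℝ), v ≠ 0 → S *ᵥ v = r • v → Pᵀ *ᵥ v = 0 → ∀ j, |r| ≤ |ev j|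

/-- The set of `d × m` real matrices as a measurable space (product Borel structure). -/
instance matrixMeasurableSpace {d m : ℕ} : MeasurableSpace (Matrix (Fin d) (Fin m) ℝ) :=
  inferInstanceAs (MeasurableSpace (Fin d → Fin m → ℝ))

/-- `qr` is a (thin) QR routine: a measurable map that returns, for every `d × m` matrix `F`, a
matrix `Q` with orthonormal columns such that `F = Q R` for some upper triangular `R`. The
`Q`-factor of a matrix is not unique (signs of the columns, rank-deficient matrices); any measurable
choice is allowed. -/
structure IsQRRoutine {d m : ℕ} (qr : Matrix (Fin d) (Fin m) ℝ → Matrix (Fin d) (Fin m) ℝ) :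
    Prop where
  measurable : Measurable qr
  orthonormal : ∀ F, (qr F)ᵀ * qr F = 1
  factor : ∀ F, ∃ R : Matrix (Fin m) (Fin m) ℝ, (∀ i j, j < i → R i j = 0) ∧ F = qr F * R

section Algorithm

/-! The iterates of the algorithm on one input: `g` is the initial `d × m` matrix, and
`s i = (a_i, x_i)`, `i = 1, 2, …`, is the stream of samples. -/

variable {d m : ℕ}

/-- The samples of group `a` in the `t`-th block `(t - 1) b < i ≤ t b`. -/
def groupIndices (b : ℕ) (s : ℕ → Fin 2 × EuclideanSpace ℝ (Fin d)) (t : ℕ) (a : Fin 2) :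
    Finset ℕ :=
  (Finset.Ioc ((t - 1) * b) (t * b)).filter fun i => (s i).1 = a

/-- The matrix `C_t^{(a)}`: the average of `x_i x_iᵀ W` over the samples of group `a` in block `t`
(it is `0` if there are none, as `(0 : ℝ)⁻¹ = 0`). -/
def groupAverage (b : ℕ) (s : ℕ → Fin 2 × EuclideanSpace ℝ (Fin d)) (t : ℕ) (a : Fin 2)
    (W : Matrix (Fin d) (Fin m) ℝ) : Matrix (Fin d) (Fin m) ℝ :=
  ((groupIndices b s t a).card : ℝ)⁻¹ • ∑ i ∈ groupIndices b s t a, outer (s i).2 * W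

/-- The iterates `W_0 = QR(g)` and `W_t = QR(C_t^{(1)} - C_t^{(0)})`, where `C_t^{(a)}` is computed
from `W_{t-1}` and the `t`-th block. -/
def iterate (qr : Matrix (Fin d) (Fin m) ℝ → Matrix (Fin d) (Fin m) ℝ) (b : ℕ)
    (g : Matrix (Fin d) (Fin m) ℝ) (s : ℕ → Fin 2 × EuclideanSpace ℝ (Fin d)) :
    ℕ → Matrix (Fin d) (Fin m) ℝ
  | 0 => qr g
  | t + 1 => qr (groupAverage b s (t + 1) 1 (iterate qr b g s t) -
      groupAverage b s (t + 1) 0 (iterate qr b g s t))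

/-- The noise matrix `Z_t = (C_t^{(1)} - C_t^{(0)}) - S W_{t-1}`, for `t ≥ 1`. -/
def noise (qr : Matrix (Fin d) (Fin m) ℝ → Matrix (Fin d) (Fin m) ℝ) (b : ℕ)
    (S : Matrix (Fin d) (Fin d) ℝ) (g : Matrix (Fin d) (Fin m) ℝ)
    (s : ℕ → Fin 2 × EuclideanSpace ℝ (Fin d)) (t : ℕ) : Matrix (Fin d) (Fin m) ℝ :=
  (groupAverage b s t 1 (iterate qr b g s (t - 1)) -
    groupAverage b s t 0 (iterate qr b g s (t - 1))) - S * iterate qr b g s (t - 1)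

end Algorithm

/-- The law of a `d × m` matrix with independent standard Gaussian entries. -/
def gaussianMatrixLaw (d m : ℕ) : Measure (Matrix (Fin d) (Fin m) ℝ) :=
  (Measure.pi fun _ : Fin d => Measure.pi fun _ : Fin m => gaussianReal 0 1)

/-- The random input of the algorithm: an initial Gaussian matrix `G` and an independent stream
`(a_i, x_i)` of i.i.d. samples with `a_i ∼ Bernoulli(p)` and `x_i | a_i ∼ D a_i`. -/
structure IsRandomInput {d m : ℕ} {Ω : Type*} [MeasurableSpace Ω] (μ : Measure Ω)
    (D : Fin 2 → Measure (EuclideanSpace ℝ (Fin d))) (p : ℝ)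
    (G : Ω → Matrix (Fin d) (Fin m) ℝ) (s : ℕ → Ω → Fin 2 × EuclideanSpace ℝ (Fin d)) :
    Prop where
  init_law : HasLaw G (gaussianMatrixLaw d m) μ
  sample_law : ∀ i, HasLaw (s i) (pairLaw D p) μ
  iid : iIndepFun s μ
  init_indep : IndepFun G (fun ω i => s i ω) μ

end FairPCA

end

/-! Fix `t`. The iterate `W = W_{t-1}` is a function of `G` and of the samples before block `t`,
hence independent of that block. By Fubini it suffices to bound the failure probability for an
arbitrary fixed `W` with orthonormal columns and an i.i.d. block.

For such a `W`, if `N_a` is the size of group `a` in the block, then the error `C_t^{(a)} - S_a W`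
equals `N_a⁻¹ (∑ 1[a_i = a] (x_i x_iᵀ - S_a)) W`. Three events per group are controlled, with `T_a =
b P(a)` the mean of `N_a`: the count stays within `T_a / 2` of `T_a`; the centred sum has small
norm; and so has its compression `Qᵀ (∑ ...) Q` to the columns of `Q = [P W]`. The compression
contains `Pᵀ (∑ ...) W` as a block, but it is a symmetric matrix of size only `2m`. This is why the
sharper bound on `Pᵀ Z` costs `log (m / δ)` and not `log (d / δ)`.

All three events follow from one matrix Bernstein bound by the Ahlswede–Winter method: `E tr exp (∑
Z_i)` is estimated one summand at a time, using the Golden–Thompson inequality `tr exp (X + Y) ≤ tr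
(exp X exp Y)` and `exp Z ≤ 1 + Z + Z²` for `‖Z‖ ≤ 1`. Golden–Thompson is itself derived from the
Lie–Trotter formula and a Hölder inequality for traces of `2 ^ k`-fold products. -/

noncomputable section

namespace FairPCA

/-! ### The Lie–Trotter product formula -/

section LieTrotter

open Filter Topology NormedSpace

variable {A : Type*} [NormedRing A] [NormOneClass A]

/-- Telescoping. Since `1 ≤ r`, the natural exponent `n - 1` may be rounded up to `n`, which avoids
truncated subtraction. -/
theorem norm_pow_sub_pow_le {x y : A} {r : ℝ} (hr : 1 ≤ r) (hx : ‖x‖ ≤ r) (hy : ‖y‖ ≤ r) (n : ℕ) :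
    ‖x ^ n - y ^ n‖ ≤ n * r ^ n * ‖x - y‖ := by
  induction n with
  | zero => simp
  | succ n ih =>
    have h : x ^ (n + 1) - y ^ (n + 1) = x * (x ^ n - y ^ n) + (x - y) * y ^ n := by
      rw [pow_succ', pow_succ']; noncomm_ring
    have hyn : ‖y ^ n‖ ≤ r ^ n := (norm_pow_le y n).trans (pow_le_pow_left₀ (norm_nonneg _) hy n)
    have hrn : r ^ n ≤ r ^ (n + 1) := pow_le_pow_right₀ hr n.le_succ
    calc ‖x ^ (n + 1) - y ^ (n + 1)‖
        ≤ ‖x‖ * ‖x ^ n - y ^ n‖ + ‖x - y‖ * ‖y ^ n‖ := by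
          rw [h]
          exact (norm_add_le _ _).trans (add_le_add (norm_mul_le _ _) (norm_mul_le _ _))
      _ ≤ r * (n * r ^ n * ‖x - y‖) + ‖x - y‖ * r ^ (n + 1) := by
          gcongr
          exact hyn.trans hrn
      _ = ((n + 1 : ℕ) : ℝ) * r ^ (n + 1) * ‖x - y‖ := by push_cast; ring

variable [NormedAlgebra ℝ A]

theorem norm_exp_le_exp_norm (x : A) : ‖exp x‖ ≤ Real.exp ‖x‖ := by
  rw [exp_eq_tsum ℝ, Real.exp_eq_exp_ℝ, exp_eq_tsum ℝ]
  have hs : Summable fun n : ℕ => ‖((n.factorial : ℝ)⁻¹) • x ^ n‖ := norm_expSeries_summable' x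
  have hs' : Summable fun n : ℕ => ((n.factorial : ℝ)⁻¹) • ‖x‖ ^ n := expSeries_summable' ‖x‖
  refine (norm_tsum_le_tsum_norm hs).trans (hs.tsum_le_tsum (fun n => ?_) hs')
  rw [norm_smul, Real.norm_of_nonneg (by positivity), smul_eq_mul]
  gcongr
  exact norm_pow_le x n

variable [CompleteSpace A]

/-- The **Lie–Trotter product formula**. -/
theorem tendsto_exp_mul_exp_pow (a b : A) :
    Tendsto (fun n : ℕ => (exp ((n : ℝ)⁻¹ • a) * exp ((n : ℝ)⁻¹ • b)) ^ n) atTop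
      (𝓝 (exp (a + b))) := by
  -- Both `f 0` and `f' 0` vanish, so `n • f (1 / n)` tends to `0`. The difference of the `n`-th
  -- powers is at most `r ^ n * ‖n • f (1 / n)‖`, and `r ^ n = exp (‖a‖ + ‖b‖)` does not depend on
  -- `n`.
  set f : ℝ → A := fun t => exp (t • a) * exp (t • b) - exp (t • (a + b)) with hf
  have hderiv : HasDerivAt f 0 0 := by
    have h := ((hasDerivAt_exp_smul_const a (0 : ℝ)).mul (hasDerivAt_exp_smul_const b (0 : ℝ))).sub
      (hasDerivAt_exp_smul_const (a + b) (0 : ℝ))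
    exact h.congr_deriv (by simp)
  have hlim : Tendsto (fun n : ℕ => (n : ℝ) • f (n : ℝ)⁻¹) atTop (𝓝 0) := by
    have h1 := hderiv.tendsto_slope_zero
    have h2 : Tendsto (fun n : ℕ => (n : ℝ)⁻¹) atTop (𝓝[≠] 0) := by
      refine tendsto_nhdsWithin_iff.2 ⟨tendsto_inv_atTop_nhds_zero_nat, ?_⟩
      filter_upwards [eventually_gt_atTop 0] with n hn
      simp [hn.ne']
    have h3 := h1.comp h2
    have hf0 : f 0 = 0 := by simp [hf]
    simpa [Function.comp_def, hf0] using h3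
  rw [tendsto_iff_norm_sub_tendsto_zero]
  have hbound : Tendsto (fun n : ℕ => Real.exp (‖a‖ + ‖b‖) * ‖(n : ℝ) • f (n : ℝ)⁻¹‖) atTop
      (𝓝 0) := by
    simpa using hlim.norm.const_mul (Real.exp (‖a‖ + ‖b‖))
  refine squeeze_zero' (Eventually.of_forall fun _ => norm_nonneg _) ?_ hbound
  filter_upwards [eventually_gt_atTop 0] with n hn
  have hn0 : (n : ℝ) ≠ 0 := by positivity
  have hpow : exp (a + b) = exp ((n : ℝ)⁻¹ • (a + b)) ^ n := by
    let _ : NormedAlgebra ℚ A := NormedAlgebra.restrictScalars ℚ ℝ A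
    rw [← exp_nsmul, ← Nat.cast_smul_eq_nsmul ℝ, smul_smul, mul_inv_cancel₀ hn0, one_smul]
  set r := Real.exp ((n : ℝ)⁻¹ * (‖a‖ + ‖b‖)) with hr
  have hr1 : 1 ≤ r := Real.one_le_exp (by positivity)
  have hnorm (c : A) : ‖(n : ℝ)⁻¹ • c‖ = (n : ℝ)⁻¹ * ‖c‖ := by
    rw [norm_smul, Real.norm_of_nonneg (by positivity)]
  have hx : ‖exp ((n : ℝ)⁻¹ • a) * exp ((n : ℝ)⁻¹ • b)‖ ≤ r := by
    rw [hr, mul_add, Real.exp_add, ← hnorm a, ← hnorm b]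
    exact (norm_mul_le _ _).trans (mul_le_mul (norm_exp_le_exp_norm _) (norm_exp_le_exp_norm _)
      (norm_nonneg _) (Real.exp_pos _).le)
  have hy : ‖exp ((n : ℝ)⁻¹ • (a + b))‖ ≤ r := by
    refine (norm_exp_le_exp_norm _).trans (Real.exp_le_exp.2 ?_)
    rw [hnorm]
    gcongr
    exact norm_add_le a b
  have hrn : r ^ n = Real.exp (‖a‖ + ‖b‖) := by
    rw [hr, ← Real.exp_nat_mul]
    congr 1
    field_simp
  rw [hpow]
  refine (norm_pow_sub_pow_le hr1 hx hy n).trans (le_of_eq ?_)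
  rw [hrn, norm_smul, Real.norm_of_nonneg (by positivity)]
  ring

end LieTrotter

/-! ### Trace inequalities and Golden–Thompson -/

section GoldenThompson

open Matrix

variable {n : Type*} [Fintype n]

/-- Cauchy–Schwarz for the Frobenius inner product, in its AM–GM form; it is the base case of the
Hölder inequality below. -/
theorem abs_trace_mul_le {M N : Matrix n n ℝ} {c : ℝ} (hM : trace (Mᵀ * M) ≤ c)
    (hN : trace (Nᵀ * N) ≤ c) : |trace (M * N)| ≤ c := by
  have hMN : trace (M * N) = ∑ i, ∑ j, M j i * N i j := by
    rw [trace_mul_comm]; simp [trace, mul_apply, mul_comm]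
  have hM' : trace (Mᵀ * M) = ∑ i, ∑ j, M j i ^ 2 := by
    simp [trace, mul_apply, pow_two]
  have hN' : trace (Nᵀ * N) = ∑ i, ∑ j, N i j ^ 2 := by
    rw [trace_mul_comm]; simp [trace, mul_apply, pow_two]
  rw [hM'] at hM
  rw [hN'] at hN
  have h : |∑ i, ∑ j, M j i * N i j| ≤ ∑ i, ∑ j, (M j i ^ 2 + N i j ^ 2) / 2 := by
    refine (Finset.abs_sum_le_sum_abs _ _).trans (Finset.sum_le_sum fun i _ =>
      (Finset.abs_sum_le_sum_abs _ _).trans (Finset.sum_le_sum fun j _ => ?_))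
    rw [abs_le]
    constructor <;> nlinarith [sq_nonneg (M j i + N i j), sq_nonneg (M j i - N i j)]
  rw [hMN]
  refine h.trans ?_
  simp only [add_div, Finset.sum_add_distrib, ← Finset.sum_div]
  linarith

variable [DecidableEq n]

/-- The product `f 0 * f 1 * ⋯ * f (2 ^ k - 1)`, multiplied out as a balanced binary tree. -/
def dyadicProd : ℕ → (ℕ → Matrix n n ℝ) → Matrix n n ℝ
  | 0, f => f 0
  | k + 1, f => dyadicProd k fun j => f (2 * j) * f (2 * j + 1)

theorem dyadicProd_const (k : ℕ) (M : Matrix n n ℝ) : dyadicProd k (fun _ => M) = M ^ 2 ^ k := by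
  induction k generalizing M with
  | zero => simp [dyadicProd]
  | succ k ih => rw [dyadicProd, ih, ← pow_two, ← pow_mul, pow_succ' 2 k]

theorem trace_mul_pow_comm (M N : Matrix n n ℝ) (k : ℕ) :
    trace ((M * N) ^ k) = trace ((N * M) ^ k) := by
  cases k with
  | zero => simp
  | succ k =>
    rw [pow_succ, ← mul_assoc, trace_mul_comm, ← mul_assoc]
    have : N * (M * N) ^ k = (N * M) ^ k * N := by
      induction k with
      | zero => simp
      | succ k ih => rw [pow_succ, ← mul_assoc, ih, pow_succ]; simp only [mul_assoc]
    rw [this, mul_assoc, pow_succ]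

/-- A Hölder inequality for the Schatten norm of order `2 ^ (k + 1)`. -/
theorem abs_trace_dyadicProd_le (k : ℕ) (f : ℕ → Matrix n n ℝ) (c : ℝ)
    (hf : ∀ j, trace (((f j)ᵀ * f j) ^ 2 ^ k) ≤ c) : |trace (dyadicProd (k + 1) f)| ≤ c := by
  induction k generalizing f with
  | zero =>
    simp only [pow_zero, pow_one] at hf
    exact abs_trace_mul_le (hf _) (hf _)
  | succ k ih =>
    rw [dyadicProd]
    refine ih _ fun j => ?_
    set M := f (2 * j)
    set N := f (2 * j + 1)
    have hsq (K : Matrix n n ℝ) (hK : Kᵀ = K) : (Kᵀ * K) ^ 2 ^ k = K ^ 2 ^ (k + 1) := by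
      rw [hK, ← pow_two, ← pow_mul, pow_succ' 2 k]
    have h1 : trace (((M * N)ᵀ * (M * N)) ^ 2 ^ k) = trace (((Mᵀ * M) * (N * Nᵀ)) ^ 2 ^ k) := by
      rw [transpose_mul, mul_assoc, trace_mul_pow_comm]
      simp only [mul_assoc]
    -- The power is again a product of `2 ^ (k + 1)` factors, alternately `Mᵀ M` and `N Nᵀ`. So the
    -- induction hypothesis applies a second time, now to symmetric factors, and its trace condition
    -- is `hf`.
    have h2 : ((Mᵀ * M) * (N * Nᵀ)) ^ 2 ^ k =
        dyadicProd (k + 1) fun i => if Even i then Mᵀ * M else N * Nᵀ := by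
      rw [dyadicProd, ← dyadicProd_const]
      congr 1
      ext1 i
      simp
    rw [h1, h2]
    refine (le_abs_self _).trans (ih _ fun i => ?_)
    split_ifs
    · rw [hsq _ (by simp)]
      exact hf _
    · rw [hsq _ (by simp), trace_mul_pow_comm]
      exact hf _

/-- Hölder with all factors equal to `X Y` gives `tr (X Y) ^ 2 ^ (k + 1) ≤ tr (X² Y²) ^ 2 ^ k`;
induction then proceeds with `X²` and `Y²`. -/
theorem trace_mul_pow_le {X Y : Matrix n n ℝ} (hX : Xᵀ = X) (hY : Yᵀ = Y) (k : ℕ) :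
    trace ((X * Y) ^ 2 ^ k) ≤ trace (X ^ 2 ^ k * Y ^ 2 ^ k) := by
  induction k generalizing X Y with
  | zero => simp
  | succ k ih =>
    have h1 : trace (((X * Y)ᵀ * (X * Y)) ^ 2 ^ k) = trace ((X ^ 2 * Y ^ 2) ^ 2 ^ k) := by
      rw [transpose_mul, hX, hY, mul_assoc, trace_mul_pow_comm]
      simp only [pow_two, mul_assoc]
    have h2 := abs_trace_dyadicProd_le k (fun _ => X * Y) _ (fun _ => h1.le)
    rw [dyadicProd_const] at h2
    refine (le_abs_self _).trans (h2.trans ((ih (X := X ^ 2) (Y := Y ^ 2) ?_ ?_).trans_eq ?_))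
    · rw [transpose_pow, hX]
    · rw [transpose_pow, hY]
    · rw [← pow_mul, ← pow_mul, pow_succ' 2 k]

open Filter Topology in
/-- The **Golden–Thompson inequality** for real symmetric matrices. -/
theorem trace_exp_add_le {X Y : Matrix n n ℝ} (hX : Xᵀ = X) (hY : Yᵀ = Y) :
    trace (NormedSpace.exp (X + Y)) ≤ trace (NormedSpace.exp X * NormedSpace.exp Y) := by
  cases isEmpty_or_nonempty n with
  | inl _ => simp [trace]
  | inr _ =>
    have hone : NormOneClass (Matrix n n ℝ) := CStarRing.instNormOneClassOfNontrivial
    -- Only the exponents `2 ^ k` are needed: along them `trace_mul_pow_le`, applied to `exp (X / 2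
    -- ^ k)` and `exp (Y / 2 ^ k)`, has a right-hand side independent of `k`.
    have hlim := (tendsto_exp_mul_exp_pow X Y).comp
      (tendsto_pow_atTop_atTop_of_one_lt (one_lt_two : 1 < 2))
    have htr : Continuous (trace : Matrix n n ℝ → ℝ) := continuous_id.matrix_trace
    refine le_of_tendsto ((htr.tendsto _).comp hlim) (Eventually.of_forall fun k => ?_)
    have hpow (Z : Matrix n n ℝ) :
        NormedSpace.exp (((2 ^ k : ℕ) : ℝ)⁻¹ • Z) ^ 2 ^ k = NormedSpace.exp Z := by
      rw [← Matrix.exp_nsmul, ← Nat.cast_smul_eq_nsmul ℝ, smul_smul,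
        mul_inv_cancel₀ (by positivity), one_smul]
    have hsymm (Z : Matrix n n ℝ) (hZ : Zᵀ = Z) : (NormedSpace.exp (((2 ^ k : ℕ) : ℝ)⁻¹ • Z))ᵀ =
        NormedSpace.exp (((2 ^ k : ℕ) : ℝ)⁻¹ • Z) := by
      rw [← Matrix.exp_transpose, transpose_smul, hZ]
    have h := trace_mul_pow_le (hsymm X hX) (hsymm Y hY) k
    rw [hpow, hpow] at h
    exact h

end GoldenThompson

/-! ### Spectral calculus for symmetric matrices -/

section Spectral

open Matrix

theorem norm_le_one_of_transpose_mul_self {k l : Type*} [Fintype k] [Fintype l] [DecidableEq k]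
    [DecidableEq l] {W : Matrix k l ℝ} (hW : Wᵀ * W = 1) : ‖W‖ ≤ 1 := by
  have h1 : ‖(1 : Matrix l l ℝ)‖ ≤ 1 := by
    rw [← diagonal_one, l2_opNorm_diagonal]
    exact (pi_norm_le_iff_of_nonneg zero_le_one).2 fun i => by simp
  have h2 := l2_opNorm_conjTranspose_mul_self W
  rw [conjTranspose_eq_transpose_of_trivial, hW] at h2
  nlinarith [norm_nonneg W]

theorem norm_transpose_eq {k l : Type*} [Fintype k] [Fintype l] [DecidableEq k]
    [DecidableEq l] (W : Matrix k l ℝ) : ‖Wᵀ‖ = ‖W‖ := by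
  rw [← conjTranspose_eq_transpose_of_trivial, l2_opNorm_conjTranspose]

variable {n : Type*} [Fintype n] [DecidableEq n]

theorem exists_orthogonal_diagonalization {H : Matrix n n ℝ} (hH : Hᵀ = H) :
    ∃ (U : Matrix n n ℝ) (l : n → ℝ), Uᵀ * U = 1 ∧ U * Uᵀ = 1 ∧ H = U * diagonal l * Uᵀ := by
  have hH' : H.IsHermitian := by rwa [IsHermitian, conjTranspose_eq_transpose_of_trivial]
  refine ⟨hH'.eigenvectorUnitary, hH'.eigenvalues, ?_, ?_, ?_⟩
  · have h := Unitary.coe_star_mul_self hH'.eigenvectorUnitary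
    rwa [star_eq_conjTranspose, conjTranspose_eq_transpose_of_trivial] at h
  · have h : (hH'.eigenvectorUnitary : Matrix n n ℝ) *
        star (hH'.eigenvectorUnitary : Matrix n n ℝ) = 1 :=
      Unitary.coe_mul_star_self hH'.eigenvectorUnitary
    rwa [star_eq_conjTranspose, conjTranspose_eq_transpose_of_trivial] at h
  · have h := hH'.spectral_theorem
    rw [Unitary.conjStarAlgAut_apply, star_eq_conjTranspose,
      conjTranspose_eq_transpose_of_trivial] at h
    exact h

theorem exp_orthogonal_conj {U : Matrix n n ℝ} (hU : U * Uᵀ = 1) (l : n → ℝ) :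
    NormedSpace.exp (U * diagonal l * Uᵀ) = U * diagonal (fun i => Real.exp (l i)) * Uᵀ := by
  have hinv : U⁻¹ = Uᵀ := inv_eq_right_inv hU
  rw [← hinv, exp_conj _ _ (IsUnit.of_mul_eq_one _ hU), exp_diagonal]
  congr 3
  ext i
  rw [Pi.coe_exp, Real.exp_eq_exp_ℝ]

theorem trace_orthogonal_conj {U : Matrix n n ℝ} (hU : Uᵀ * U = 1) (l : n → ℝ) :
    trace (U * diagonal l * Uᵀ) = ∑ i, l i := by
  rw [trace_mul_comm, ← mul_assoc, hU, one_mul, trace_diagonal]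

theorem posSemidef_exp {H : Matrix n n ℝ} (hH : Hᵀ = H) : (NormedSpace.exp H).PosSemidef := by
  obtain ⟨U, l, hU, hU', rfl⟩ := exists_orthogonal_diagonalization hH
  rw [exp_orthogonal_conj hU', ← conjTranspose_eq_transpose_of_trivial]
  exact (PosSemidef.diagonal fun i => (Real.exp_pos _).le).mul_mul_conjTranspose_same U

/-- The norm is at most `|λ|` for some eigenvalue `λ`, and `exp |λ|` is one of the positive terms of
one of the two traces. Both traces are needed because `λ` may have either sign. -/
theorem exp_norm_le_trace_exp_add [Nonempty n] {H : Matrix n n ℝ} (hH : Hᵀ = H) :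
    Real.exp ‖H‖ ≤ trace (NormedSpace.exp H) + trace (NormedSpace.exp (-H)) := by
  obtain ⟨U, l, hU, hU', rfl⟩ := exists_orthogonal_diagonalization hH
  have hneg : -(U * diagonal l * Uᵀ) = U * diagonal (-l) * Uᵀ := by
    rw [show diagonal (-l) = -diagonal l from (diagonal_neg l).symm, mul_neg,
      neg_mul]
  rw [hneg, exp_orthogonal_conj hU', exp_orthogonal_conj hU', trace_orthogonal_conj hU,
    trace_orthogonal_conj hU]
  obtain ⟨i, hi⟩ : ∃ i, ‖l‖ = |l i| := by
    obtain ⟨i, -, hi⟩ := Finset.exists_mem_eq_sup' (Finset.univ_nonempty) fun i => ‖l i‖₊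
    refine ⟨i, ?_⟩
    rw [Pi.norm_def, ← Finset.sup'_eq_sup Finset.univ_nonempty, hi]
    simp
  have hnorm : ‖U * diagonal l * Uᵀ‖ ≤ |l i| := by
    have h1 : ‖U‖ ≤ 1 := norm_le_one_of_transpose_mul_self hU
    calc ‖U * diagonal l * Uᵀ‖ ≤ ‖U‖ * ‖diagonal l‖ * ‖Uᵀ‖ :=
          (l2_opNorm_mul _ _).trans (mul_le_mul_of_nonneg_right (l2_opNorm_mul _ _) (norm_nonneg _))
      _ ≤ 1 * ‖diagonal l‖ * 1 := by
          rw [norm_transpose_eq]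
          gcongr
      _ = |l i| := by rw [l2_opNorm_diagonal, hi]; ring
  have hs1 : Real.exp (l i) ≤ ∑ j, Real.exp (l j) :=
    Finset.single_le_sum (f := fun j => Real.exp (l j)) (fun j _ => (Real.exp_pos _).le)
      (Finset.mem_univ i)
  have hs2 : Real.exp (-l i) ≤ ∑ j, Real.exp ((-l) j) :=
    Finset.single_le_sum (f := fun j => Real.exp ((-l) j)) (fun j _ => (Real.exp_pos _).le)
      (Finset.mem_univ i)
  refine (Real.exp_le_exp.2 hnorm).trans ?_
  cases abs_choice (l i) with
  | inl h => rw [h]; linarith [Real.exp_pos (-l i)]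
  | inr h => rw [h]; linarith [Real.exp_pos (l i)]

/-- The scalar inequality `exp x ≤ 1 + x + x²` for `|x| ≤ 1`, applied to each eigenvalue. -/
theorem posSemidef_one_add_add_sq_sub_exp {Y : Matrix n n ℝ} (hY : Yᵀ = Y) (hY1 : ‖Y‖ ≤ 1) :
    (1 + Y + Y * Y - NormedSpace.exp Y).PosSemidef := by
  obtain ⟨U, l, hU, hU', rfl⟩ := exists_orthogonal_diagonalization hY
  have hl : ‖diagonal l‖ ≤ 1 := by
    have h1 : ‖U‖ ≤ 1 := norm_le_one_of_transpose_mul_self hU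
    have h2 : diagonal l = Uᵀ * (U * diagonal l * Uᵀ) * U := by
      calc diagonal l = (Uᵀ * U) * diagonal l * (Uᵀ * U) := by simp [hU]
        _ = _ := by simp only [mul_assoc]
    rw [h2]
    calc ‖Uᵀ * (U * diagonal l * Uᵀ) * U‖ ≤ ‖Uᵀ‖ * ‖U * diagonal l * Uᵀ‖ * ‖U‖ :=
          (l2_opNorm_mul _ _).trans (mul_le_mul_of_nonneg_right (l2_opNorm_mul _ _) (norm_nonneg _))
      _ ≤ 1 * 1 * 1 := by
          rw [norm_transpose_eq]
          gcongr
      _ = 1 := by norm_num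
  rw [l2_opNorm_diagonal] at hl
  have hsq : U * diagonal l * Uᵀ * (U * diagonal l * Uᵀ) =
      U * diagonal (fun i => l i * l i) * Uᵀ := by
    rw [← diagonal_mul_diagonal]
    calc _ = U * diagonal l * (Uᵀ * U) * diagonal l * Uᵀ := by simp only [mul_assoc]
      _ = _ := by rw [hU]; simp only [mul_assoc, one_mul]
  have hone : (1 : Matrix n n ℝ) = U * diagonal (fun _ => 1) * Uᵀ := by
    rw [diagonal_one, mul_one, hU']
  have heq : 1 + U * diagonal l * Uᵀ + U * diagonal l * Uᵀ * (U * diagonal l * Uᵀ) -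
      NormedSpace.exp (U * diagonal l * Uᵀ) =
      U * diagonal (fun i => 1 + l i + l i * l i - Real.exp (l i)) * Uᵀ := by
    rw [exp_orthogonal_conj hU', hsq]
    nth_rw 1 [hone]
    rw [← add_mul, ← mul_add, ← add_mul, ← mul_add, ← sub_mul, ← mul_sub, diagonal_add,
      diagonal_add, diagonal_sub]
  rw [heq, ← conjTranspose_eq_transpose_of_trivial]
  refine (PosSemidef.diagonal fun i => ?_).mul_mul_conjTranspose_same U
  have hi : |l i| ≤ 1 := (norm_le_pi_norm l i).trans hl
  have h := (abs_le.1 (Real.abs_exp_sub_one_sub_id_le hi)).2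
  simp only [Pi.zero_apply]
  nlinarith

end Spectral

/-! ### Matrix Laplace transform and tail bound -/

section MomentGeneratingFunction

open Matrix

instance matrixBorelSpace {d m : ℕ} : BorelSpace (Matrix (Fin d) (Fin m) ℝ) :=
  inferInstanceAs (BorelSpace (Fin d → Fin m → ℝ))

instance matrixSecondCountable {d m : ℕ} : SecondCountableTopology (Matrix (Fin d) (Fin m) ℝ) :=
  inferInstanceAs (SecondCountableTopology (Fin d → Fin m → ℝ))

theorem measurable_matrix_iff {d m : ℕ} {α : Type*} [MeasurableSpace α]
    {f : α → Matrix (Fin d) (Fin m) ℝ} : Measurable f ↔ ∀ i j, Measurable fun x => f x i j :=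
  measurable_pi_iff.trans (forall_congr' fun _ => measurable_pi_iff)

theorem abs_apply_le_norm {k l : Type*} [Fintype k] [Fintype l] [DecidableEq k] [DecidableEq l]
    (A : Matrix k l ℝ) (i : k) (j : l) : |A i j| ≤ ‖A‖ := by
  have h := l2_opNorm_mulVec A (EuclideanSpace.single j 1)
  have h2 := PiLp.norm_apply_le (WithLp.toLp 2 (A *ᵥ (EuclideanSpace.single j (1 : ℝ)).ofLp)) i
  simp at h h2
  exact h2.trans h

variable {n : ℕ}

theorem continuous_trace_exp :
    Continuous fun A : Matrix (Fin n) (Fin n) ℝ => trace (NormedSpace.exp A) := by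
  let _ : NormedAlgebra ℚ (Matrix (Fin n) (Fin n) ℝ) := NormedAlgebra.restrictScalars ℚ ℝ _
  exact (NormedSpace.exp_continuous).matrix_trace

variable {Ω : Type*} [MeasurableSpace Ω] {μ : Measure Ω}

/-- A random symmetric matrix with mean zero, spectral norm at most `1`, and whose second moment is
at most `v` in the Loewner order. -/
structure IsCenteredContraction (μ : Measure Ω) (v : ℝ) (Z : Ω → Matrix (Fin n) (Fin n) ℝ) :
    Prop where
  measurable : Measurable Z
  symm : ∀ ω, (Z ω)ᵀ = Z ω
  norm_le : ∀ᵐ ω ∂μ, ‖Z ω‖ ≤ 1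
  mean : ∀ i j, ∫ ω, Z ω i j ∂μ = 0
  variance : ∀ u : Fin n → ℝ, ∫ ω, (Z ω *ᵥ u) ⬝ᵥ (Z ω *ᵥ u) ∂μ ≤ v * (u ⬝ᵥ u)

theorem IsCenteredContraction.neg {v : ℝ} {Z : Ω → Matrix (Fin n) (Fin n) ℝ}
    (hZ : IsCenteredContraction μ v Z) : IsCenteredContraction μ v fun ω => -Z ω where
  measurable := hZ.measurable.neg
  symm ω := by rw [transpose_neg, hZ.symm]
  norm_le := by simpa using hZ.norm_le
  mean i j := by simpa [integral_neg] using hZ.mean i j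
  variance u := by simpa [neg_mulVec] using hZ.variance u

variable [IsProbabilityMeasure μ]

/-- Golden–Thompson splits off `exp H`; then `exp Z ≤ 1 + Z + Z²`, whose expectation is at most `1 +
v ≤ exp v` in the Loewner order. The lower integral spares any integrability check for the matrix
exponential. -/
theorem IsCenteredContraction.lintegral_trace_exp_add_le {v : ℝ}
    {Z : Ω → Matrix (Fin n) (Fin n) ℝ} (hZ : IsCenteredContraction μ v Z)
    {H : Matrix (Fin n) (Fin n) ℝ} (hH : Hᵀ = H) :
    ∫⁻ ω, ENNReal.ofReal (trace (NormedSpace.exp (H + Z ω))) ∂μ ≤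
      ENNReal.ofReal (Real.exp v) * ENNReal.ofReal (trace (NormedSpace.exp H)) := by
  -- The vectors `B k` are the rows of `exp (H / 2)`. They turn the trace against `exp H` into a sum
  -- of quadratic forms, on which Loewner bounds and expectations act vector by vector.
  obtain ⟨B, htr⟩ : ∃ B : Fin n → Fin n → ℝ, ∀ M : Matrix (Fin n) (Fin n) ℝ,
      trace (NormedSpace.exp H * M) = ∑ k, B k ⬝ᵥ (M *ᵥ B k) := by
    refine ⟨fun k j => NormedSpace.exp ((1 / 2 : ℝ) • H) k j, fun M => ?_⟩
    have hB : NormedSpace.exp H =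
        (NormedSpace.exp ((1 / 2 : ℝ) • H))ᵀ * NormedSpace.exp ((1 / 2 : ℝ) • H) := by
      rw [← exp_transpose, transpose_smul, hH, ← exp_add_of_commute _ _ (Commute.refl _),
        ← add_smul]
      norm_num
    rw [hB, mul_assoc, trace_mul_comm]
    simp only [trace, diag_apply, mul_assoc, mul_apply, transpose_apply, dotProduct, mulVec]
  have hint (i j : Fin n) : Integrable (fun ω => Z ω i j) μ := by
    refine Integrable.of_bound (measurable_matrix_iff.1 hZ.measurable i j).aestronglyMeasurable 1 ?_
    filter_upwards [hZ.norm_le] with ω hω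
    exact (abs_apply_le_norm _ i j).trans hω
  have hint1 (u : Fin n → ℝ) : Integrable (fun ω => u ⬝ᵥ (Z ω *ᵥ u)) μ := by
    simp only [dotProduct, mulVec]
    exact integrable_finsetSum _ fun i _ => (integrable_finsetSum _ fun j _ =>
      (hint i j).mul_const _).const_mul _
  have hint1' (u : Fin n → ℝ) : ∫ ω, u ⬝ᵥ (Z ω *ᵥ u) ∂μ = 0 := by
    simp only [dotProduct, mulVec]
    rw [integral_finsetSum _ fun i _ => (integrable_finsetSum _ fun j _ =>
      (hint i j).mul_const _).const_mul _]
    refine Finset.sum_eq_zero fun i _ => ?_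
    rw [integral_const_mul, integral_finsetSum _ fun j _ => (hint i j).mul_const _]
    simp [integral_mul_const, hZ.mean]
  have hint2 (u : Fin n → ℝ) : Integrable (fun ω => (Z ω *ᵥ u) ⬝ᵥ (Z ω *ᵥ u)) μ := by
    simp only [dotProduct, mulVec]
    refine integrable_finsetSum _ fun i _ => ?_
    simp only [Finset.sum_mul_sum]
    refine integrable_finsetSum _ fun j _ => integrable_finsetSum _ fun k _ => ?_
    have hbd : Integrable (fun ω => Z ω i j * Z ω i k) μ := by
      refine (hint i k).bdd_mul (c := 1)
        (measurable_matrix_iff.1 hZ.measurable i j).aestronglyMeasurable ?_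
      filter_upwards [hZ.norm_le] with ω hω
      exact (abs_apply_le_norm _ i j).trans hω
    refine (hbd.const_mul (u j * u k)).congr (ae_of_all _ fun ω => ?_)
    simp only
    ring
  set g : Ω → ℝ := fun ω => ∑ k, (B k ⬝ᵥ B k + B k ⬝ᵥ (Z ω *ᵥ B k) +
    (Z ω *ᵥ B k) ⬝ᵥ (Z ω *ᵥ B k)) with hg
  have hle : ∀ᵐ ω ∂μ, trace (NormedSpace.exp (H + Z ω)) ≤ g ω := by
    filter_upwards [hZ.norm_le] with ω hω
    refine (trace_exp_add_le hH (hZ.symm ω)).trans ?_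
    rw [htr]
    refine Finset.sum_le_sum fun k _ => ?_
    have h := (posSemidef_one_add_add_sq_sub_exp (hZ.symm ω) hω).dotProduct_mulVec_nonneg (B k)
    simp only [star_trivial, sub_mulVec, add_mulVec, one_mulVec, dotProduct_sub, dotProduct_add]
      at h
    have hsq : B k ⬝ᵥ ((Z ω * Z ω) *ᵥ B k) = (Z ω *ᵥ B k) ⬝ᵥ (Z ω *ᵥ B k) := by
      rw [← mulVec_mulVec, dotProduct_mulVec, ← mulVec_transpose, hZ.symm]
    linarith
  have hgk (k : Fin n) : Integrable (fun ω => B k ⬝ᵥ B k + B k ⬝ᵥ (Z ω *ᵥ B k) +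
      (Z ω *ᵥ B k) ⬝ᵥ (Z ω *ᵥ B k)) μ :=
    ((integrable_const _).add (hint1 _)).add (hint2 _)
  have hgint : Integrable g μ := integrable_finsetSum _ fun k _ => hgk k
  have hg0 : 0 ≤ᵐ[μ] g := by
    filter_upwards [hle] with ω hω
    refine le_trans ?_ hω
    exact (posSemidef_exp (by rw [transpose_add, hH, hZ.symm])).trace_nonneg
  have htrH : trace (NormedSpace.exp H) = ∑ k, B k ⬝ᵥ B k := by
    have := htr 1
    simpa using this
  have hgle : ∫ ω, g ω ∂μ ≤ Real.exp v * trace (NormedSpace.exp H) := by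
    simp only [hg]
    rw [integral_finsetSum _ fun k _ => hgk k, htrH, Finset.mul_sum]
    refine Finset.sum_le_sum fun k _ => ?_
    have h1 := integral_add ((integrable_const (μ := μ) (B k ⬝ᵥ B k)).add (hint1 (B k)))
      (hint2 (B k))
    have h2 := integral_add (integrable_const (μ := μ) (B k ⬝ᵥ B k)) (hint1 (B k))
    simp only [Pi.add_apply] at h1 h2
    rw [h1, h2, hint1', integral_const, probReal_univ, one_smul]
    have h3 : 0 ≤ B k ⬝ᵥ B k := Finset.sum_nonneg fun i _ => mul_self_nonneg _
    nlinarith [hZ.variance (B k), Real.add_one_le_exp v]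
  calc ∫⁻ ω, ENNReal.ofReal (trace (NormedSpace.exp (H + Z ω))) ∂μ
      ≤ ∫⁻ ω, ENNReal.ofReal (g ω) ∂μ := by
        refine lintegral_mono_ae ?_
        filter_upwards [hle] with ω hω
        exact ENNReal.ofReal_le_ofReal hω
    _ = ENNReal.ofReal (∫ ω, g ω ∂μ) := (ofReal_integral_eq_lintegral_ofReal hgint hg0).symm
    _ ≤ _ := by
        rw [← ENNReal.ofReal_mul (Real.exp_pos v).le]
        exact ENNReal.ofReal_le_ofReal hgle

/-- Ahlswede–Winter induction: the new summand is independent of the sum of the others, so it is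
integrated out first, at the cost of a factor `exp v`. The empty sum contributes `tr 1 = n`. -/
theorem lintegral_trace_exp_sum_le {ι : Type*} {v : ℝ}
    {Z : ι → Ω → Matrix (Fin n) (Fin n) ℝ} (hZ : ∀ i, IsCenteredContraction μ v (Z i))
    (hind : iIndepFun Z μ) (s : Finset ι) :
    ∫⁻ ω, ENNReal.ofReal (trace (NormedSpace.exp (∑ i ∈ s, Z i ω))) ∂μ ≤
      ENNReal.ofReal (Real.exp v) ^ s.card * n := by
  classical
  induction s using Finset.induction_on with
  | empty => simp
  | insert i s hi ih =>
    set S : Ω → Matrix (Fin n) (Fin n) ℝ := fun ω => ∑ j ∈ s, Z j ω with hS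
    have hSm : Measurable S := Finset.measurable_sum _ fun j _ => (hZ j).measurable
    have hSZ : IndepFun S (Z i) μ := by
      have h := hind.indepFun_finsetSum_of_notMem (fun j => (hZ j).measurable) hi
      convert h using 1
      ext1 ω
      simp [hS]
    have hlaw := hSZ.map_prod_eq_prod_map_map hSm.aemeasurable (hZ i).measurable.aemeasurable
    have hm : Measurable fun q : Matrix (Fin n) (Fin n) ℝ × Matrix (Fin n) (Fin n) ℝ =>
        ENNReal.ofReal (trace (NormedSpace.exp (q.1 + q.2))) :=
      (continuous_trace_exp.comp (continuous_fst.add continuous_snd)).measurable.ennreal_ofReal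
    have hprob : IsProbabilityMeasure (μ.map (Z i)) :=
      Measure.isProbabilityMeasure_map (hZ i).measurable.aemeasurable
    have hprob' : IsProbabilityMeasure (μ.map S) :=
      Measure.isProbabilityMeasure_map hSm.aemeasurable
    calc ∫⁻ ω, ENNReal.ofReal (trace (NormedSpace.exp (∑ j ∈ insert i s, Z j ω))) ∂μ
        = ∫⁻ ω, ENNReal.ofReal (trace (NormedSpace.exp (S ω + Z i ω))) ∂μ := by
          simp_rw [Finset.sum_insert hi, hS, add_comm]
      _ = ∫⁻ q, ENNReal.ofReal (trace (NormedSpace.exp (q.1 + q.2)))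
            ∂(μ.map fun ω => (S ω, Z i ω)) :=
          (lintegral_map hm (hSm.prodMk (hZ i).measurable)).symm
      _ = ∫⁻ A, ∫⁻ B, ENNReal.ofReal (trace (NormedSpace.exp (A + B))) ∂(μ.map (Z i))
            ∂(μ.map S) := by rw [hlaw, lintegral_prod _ hm.aemeasurable]
      _ = ∫⁻ ω, ∫⁻ ω', ENNReal.ofReal (trace (NormedSpace.exp (S ω + Z i ω'))) ∂μ ∂μ := by
          rw [lintegral_map hm.lintegral_prod_right' hSm]
          refine lintegral_congr fun ω => ?_
          exact lintegral_map (hm.comp measurable_prodMk_left) (hZ i).measurable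
      _ ≤ ∫⁻ ω, ENNReal.ofReal (Real.exp v) *
            ENNReal.ofReal (trace (NormedSpace.exp (S ω))) ∂μ := by
          refine lintegral_mono fun ω => (hZ i).lintegral_trace_exp_add_le ?_
          simp [hS, transpose_sum, (hZ _).symm]
      _ ≤ ENNReal.ofReal (Real.exp v) ^ (insert i s).card * n := by
          have hSe : Measurable fun ω => ENNReal.ofReal (trace (NormedSpace.exp (S ω))) :=
            (continuous_trace_exp.measurable.comp hSm).ennreal_ofReal
          rw [lintegral_const_mul _ hSe, Finset.card_insert_of_notMem hi,
            pow_succ', mul_assoc]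
          gcongr

/-- Markov's inequality for `tr exp S + tr exp (-S)`. There is no Laplace parameter to optimise
here: it is absorbed into `Z` by rescaling when the bound is applied. -/
theorem measure_le_norm_sum_le {ι : Type*} {v : ℝ} (hn : 0 < n)
    {Z : ι → Ω → Matrix (Fin n) (Fin n) ℝ} (hZ : ∀ i, IsCenteredContraction μ v (Z i))
    (hind : iIndepFun Z μ) (s : Finset ι) (t : ℝ) :
    μ {ω | t ≤ ‖∑ i ∈ s, Z i ω‖} ≤ ENNReal.ofReal (2 * n * Real.exp (s.card * v - t)) := by
  have : Nonempty (Fin n) := ⟨⟨0, hn⟩⟩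
  set S : Ω → Matrix (Fin n) (Fin n) ℝ := fun ω => ∑ j ∈ s, Z j ω with hS
  have hSm : Measurable S := Finset.measurable_sum _ fun j _ => (hZ j).measurable
  have hsymm (ω : Ω) : (S ω)ᵀ = S ω := by simp [hS, transpose_sum, (hZ _).symm]
  have h1 := lintegral_trace_exp_sum_le hZ hind s
  have h2 := lintegral_trace_exp_sum_le (fun i => (hZ i).neg)
    (hind.comp (fun _ A => -A) fun _ => measurable_neg) s
  simp only [Finset.sum_neg_distrib] at h2
  have hsub : {ω | t ≤ ‖S ω‖} ⊆ {ω | ENNReal.ofReal (Real.exp t) ≤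
      ENNReal.ofReal (trace (NormedSpace.exp (S ω))) +
        ENNReal.ofReal (trace (NormedSpace.exp (-S ω)))} := by
    intro ω hω
    have hneg : (-S ω)ᵀ = -S ω := by rw [transpose_neg, hsymm]
    rw [Set.mem_ofPred_eq, ← ENNReal.ofReal_add (posSemidef_exp (hsymm ω)).trace_nonneg
      (posSemidef_exp hneg).trace_nonneg]
    exact ENNReal.ofReal_le_ofReal
      ((Real.exp_le_exp.2 hω).trans (exp_norm_le_trace_exp_add (hsymm ω)))
  have hm1 : Measurable fun ω => ENNReal.ofReal (trace (NormedSpace.exp (S ω))) :=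
    (continuous_trace_exp.measurable.comp hSm).ennreal_ofReal
  have hm2 : Measurable fun ω => ENNReal.ofReal (trace (NormedSpace.exp (-S ω))) :=
    (continuous_trace_exp.measurable.comp hSm.neg).ennreal_ofReal
  have hmarkov := mul_meas_ge_le_lintegral (μ := μ) (hm1.add hm2) (ENNReal.ofReal (Real.exp t))
  simp only [Pi.add_apply] at hmarkov
  rw [lintegral_add_left hm1] at hmarkov
  have hexp : ENNReal.ofReal (2 * n * Real.exp (s.card * v - t)) =
      (ENNReal.ofReal (Real.exp v) ^ s.card * n + ENNReal.ofReal (Real.exp v) ^ s.card * n) /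
        ENNReal.ofReal (Real.exp t) := by
    rw [← ENNReal.ofReal_pow (Real.exp_pos v).le, ← Real.exp_nat_mul,
      ← ENNReal.ofReal_natCast n, ← ENNReal.ofReal_mul (Real.exp_pos _).le,
      ← ENNReal.ofReal_add (by positivity) (by positivity),
      ← ENNReal.ofReal_div_of_pos (Real.exp_pos t), Real.exp_sub]
    congr 1
    ring
  rw [hexp, ENNReal.le_div_iff_mul_le (by left; simp [Real.exp_pos]) (by left; simp), mul_comm]
  exact (mul_le_mul_right (measure_mono hsub) _).trans (hmarkov.trans (add_le_add h1 h2))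

end MomentGeneratingFunction

/-! ### Moments of the deviation of `x xᵀ` within a group -/

section Moments

open Matrix

variable {d n : ℕ}

theorem norm_toLp_sq {k : Type*} [Fintype k] (w : k → ℝ) : ‖WithLp.toLp 2 w‖ ^ 2 = w ⬝ᵥ w := by
  rw [EuclideanSpace.norm_sq_eq]
  simp [dotProduct, pow_two]

theorem dotProduct_mulVec_self_le {k l : Type*} [Fintype k] [Fintype l] [DecidableEq k]
    [DecidableEq l] (A : Matrix k l ℝ) (u : l → ℝ) :
    (A *ᵥ u) ⬝ᵥ (A *ᵥ u) ≤ ‖A‖ ^ 2 * (u ⬝ᵥ u) := by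
  have h := l2_opNorm_mulVec A (WithLp.toLp 2 u)
  rw [← norm_toLp_sq, ← norm_toLp_sq, ← mul_pow]
  exact pow_le_pow_left₀ (norm_nonneg _) h 2

theorem dotProduct_mulVec_le_norm_mul {k : Type*} [Fintype k] [DecidableEq k]
    (A : Matrix k k ℝ) (u : k → ℝ) : u ⬝ᵥ (A *ᵥ u) ≤ ‖A‖ * (u ⬝ᵥ u) := by
  have h1 := dotProduct_mulVec_self_le A u
  have h2 : (u ⬝ᵥ (A *ᵥ u)) ^ 2 ≤ (u ⬝ᵥ u) * ((A *ᵥ u) ⬝ᵥ (A *ᵥ u)) := by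
    simpa [dotProduct, pow_two] using Finset.sum_mul_sq_le_sq_mul_sq Finset.univ u (A *ᵥ u)
  have h0 : 0 ≤ u ⬝ᵥ u := Finset.sum_nonneg fun i _ => mul_self_nonneg _
  refine le_of_sq_le_sq ?_ (by positivity)
  calc (u ⬝ᵥ (A *ᵥ u)) ^ 2 ≤ (u ⬝ᵥ u) * (‖A‖ ^ 2 * (u ⬝ᵥ u)) :=
        h2.trans (mul_le_mul_of_nonneg_left h1 h0)
    _ = (‖A‖ * (u ⬝ᵥ u)) ^ 2 := by ring

theorem outer_transpose (x : EuclideanSpace ℝ (Fin d)) : (outer x)ᵀ = outer x := by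
  ext i j
  simp [outer, mul_comm]

theorem measurable_outer : Measurable (outer : EuclideanSpace ℝ (Fin d) → _) := by
  refine measurable_matrix_iff.2 fun i j => ?_
  simp only [outer, of_apply]
  fun_prop

theorem secondMoment_transpose (D : Measure (EuclideanSpace ℝ (Fin d))) :
    (secondMoment D)ᵀ = secondMoment D := by
  ext i j
  simp [secondMoment, expect, outer, mul_comm]

/-- The deviation of `x xᵀ` from its mean under `D`. -/
def outerDev (D : Measure (EuclideanSpace ℝ (Fin d))) (x : EuclideanSpace ℝ (Fin d)) :
    Matrix (Fin d) (Fin d) ℝ :=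
  outer x - secondMoment D

theorem outerDev_transpose (D : Measure (EuclideanSpace ℝ (Fin d)))
    (x : EuclideanSpace ℝ (Fin d)) : (outerDev D x)ᵀ = outerDev D x := by
  rw [outerDev, transpose_sub, outer_transpose, secondMoment_transpose]

theorem measurable_outerDev (D : Measure (EuclideanSpace ℝ (Fin d))) : Measurable (outerDev D) :=
  measurable_outer.sub_const _

variable {D : Measure (EuclideanSpace ℝ (Fin d))}

theorem dotProduct_outerDev_mulVec (x : EuclideanSpace ℝ (Fin d)) (u : Fin d → ℝ) :
    (outerDev D x *ᵥ u) ⬝ᵥ (outerDev D x *ᵥ u) =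
      ∑ i, ∑ j, ∑ k, outerDev D x i j * outerDev D x i k * (u j * u k) := by
  simp only [dotProduct, mulVec, Finset.sum_mul_sum]
  refine Finset.sum_congr rfl fun i _ => Finset.sum_congr rfl fun j _ =>
    Finset.sum_congr rfl fun k _ => by ring

variable [IsProbabilityMeasure D] {K V : ℝ}

theorem integrable_outerDev (hK : ∀ᵐ x ∂D, ‖outerDev D x‖ ≤ K) (i j : Fin d) :
    Integrable (fun x => outerDev D x i j) D := by
  refine Integrable.of_bound
    (measurable_matrix_iff.1 (measurable_outerDev D) i j).aestronglyMeasurable K ?_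
  filter_upwards [hK] with x hx
  exact (abs_apply_le_norm _ i j).trans hx

theorem integral_outerDev (hK : ∀ᵐ x ∂D, ‖outerDev D x‖ ≤ K) (i j : Fin d) :
    ∫ x, outerDev D x i j ∂D = 0 := by
  -- Existence of the second moment is not a separate assumption: boundedness of the deviation from
  -- a constant matrix already makes the entries integrable.
  have h1 : Integrable (fun x => outer x i j) D := by
    have h := (integrable_outerDev hK i j).add (integrable_const (secondMoment D i j))
    refine h.congr (ae_of_all _ fun x => ?_)
    simp [outerDev]
  simp only [outerDev, Matrix.sub_apply]
  rw [integral_sub h1 (integrable_const _), integral_const, probReal_univ, one_smul]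
  simp [secondMoment, expect]

theorem integrable_outerDev_mul (hK : ∀ᵐ x ∂D, ‖outerDev D x‖ ≤ K) (i j k l : Fin d) :
    Integrable (fun x => outerDev D x i j * outerDev D x k l) D := by
  refine (integrable_outerDev hK k l).bdd_mul (c := K)
    (measurable_matrix_iff.1 (measurable_outerDev D) i j).aestronglyMeasurable ?_
  filter_upwards [hK] with x hx
  exact (abs_apply_le_norm _ i j).trans hx

theorem integrable_outerDev_mulVec (hK : ∀ᵐ x ∂D, ‖outerDev D x‖ ≤ K) (u : Fin d → ℝ) :
    Integrable (fun x => (outerDev D x *ᵥ u) ⬝ᵥ (outerDev D x *ᵥ u)) D := by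
  simp only [dotProduct_outerDev_mulVec]
  exact integrable_finsetSum _ fun i _ => integrable_finsetSum _ fun j _ =>
    integrable_finsetSum _ fun k _ => (integrable_outerDev_mul hK i j i k).mul_const _

/-- The left side is the quadratic form `uᵀ E[Zᵀ Z] u`, and `‖E[Zᵀ Z]‖` is one of the two terms of
the variance. -/
theorem integral_outerDev_mulVec_le (hK : ∀ᵐ x ∂D, ‖outerDev D x‖ ≤ K)
    (hV : outerVariance D ≤ V) (u : Fin d → ℝ) :
    ∫ x, (outerDev D x *ᵥ u) ⬝ᵥ (outerDev D x *ᵥ u) ∂D ≤ V * (u ⬝ᵥ u) := by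
  set E := expect D fun x => (outerDev D x)ᵀ * outerDev D x with hE
  have hEV : ‖E‖ ≤ V := (le_max_right _ _).trans hV
  have h0 : 0 ≤ u ⬝ᵥ u := Finset.sum_nonneg fun i _ => mul_self_nonneg _
  refine le_trans (le_of_eq ?_)
    ((dotProduct_mulVec_le_norm_mul E u).trans (mul_le_mul_of_nonneg_right hEV h0))
  have hEentry (j k : Fin d) : E j k = ∑ i, ∫ x, outerDev D x i j * outerDev D x i k ∂D := by
    simp only [hE, expect, of_apply, mul_apply, transpose_apply]
    exact integral_finsetSum _ fun i _ => integrable_outerDev_mul hK i j i k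
  have hint (i j k : Fin d) :
      Integrable (fun x => outerDev D x i j * outerDev D x i k * (u j * u k)) D :=
    (integrable_outerDev_mul hK i j i k).mul_const _
  simp only [dotProduct_outerDev_mulVec]
  rw [integral_finsetSum _ fun i _ => integrable_finsetSum _ fun j _ =>
    integrable_finsetSum _ fun k _ => hint i j k]
  have h1 (i : Fin d) : ∫ x, ∑ j, ∑ k, outerDev D x i j * outerDev D x i k * (u j * u k) ∂D =
      ∑ j, ∑ k, (∫ x, outerDev D x i j * outerDev D x i k ∂D) * (u j * u k) := by
    rw [integral_finsetSum _ fun j _ => integrable_finsetSum _ fun k _ => hint i j k]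
    refine Finset.sum_congr rfl fun j _ => ?_
    rw [integral_finsetSum _ fun k _ => hint i j k]
    exact Finset.sum_congr rfl fun k _ => integral_mul_const _ _
  simp only [h1, dotProduct, mulVec, hEentry, Finset.sum_mul, Finset.mul_sum]
  rw [Finset.sum_comm]
  refine Finset.sum_congr rfl fun j _ => ?_
  rw [Finset.sum_comm]
  refine Finset.sum_congr rfl fun k _ => Finset.sum_congr rfl fun i _ => by ring

end Moments

/-! ### Integration against the law of `(a, x)` -/

section PairLaw

open Matrix

variable {d n : ℕ} {D : Fin 2 → Measure (EuclideanSpace ℝ (Fin d))} {p : ℝ}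

/-- The probability that a sample belongs to group `a`. -/
def groupProb (p : ℝ) (a : Fin 2) : ℝ := if a = 0 then 1 - p else p

theorem pairLaw_eq_sum (D : Fin 2 → Measure (EuclideanSpace ℝ (Fin d)))
    [∀ a, IsProbabilityMeasure (D a)] (p : ℝ) :
    pairLaw D p = ∑ a, ENNReal.ofReal (groupProb p a) • (D a).map (Prod.mk a) := by
  simp [pairLaw, groupProb, Fin.sum_univ_two, Measure.dirac_prod]

/-- The indicator of membership in group `a`. -/
def groupInd (a : Fin 2) (y : Fin 2 × EuclideanSpace ℝ (Fin d)) : ℝ := if y.1 = a then 1 else 0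

theorem measurable_groupInd (a : Fin 2) :
    Measurable (groupInd a : Fin 2 × EuclideanSpace ℝ (Fin d) → ℝ) :=
  Measurable.ite (measurable_fst (measurableSet_singleton a)) measurable_const measurable_const

/-- The centred contribution of one sample to the second moment matrix of group `a`. -/
def groupDev (D : Fin 2 → Measure (EuclideanSpace ℝ (Fin d))) (a : Fin 2)
    (y : Fin 2 × EuclideanSpace ℝ (Fin d)) : Matrix (Fin d) (Fin d) ℝ :=
  groupInd a y • outerDev (D a) y.2

theorem measurable_groupDev (a : Fin 2) : Measurable (groupDev D a) :=
  (measurable_groupInd a).smul ((measurable_outerDev _).comp measurable_snd)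

theorem measurable_sandwich (B C : Matrix (Fin d) (Fin n) ℝ) :
    Measurable fun A : Matrix (Fin d) (Fin d) ℝ => Bᵀ * A * C := by
  have h : Continuous fun A : Matrix (Fin d) (Fin d) ℝ => Bᵀ * A * C := by fun_prop
  exact h.measurable

variable [∀ a, IsProbabilityMeasure (D a)]

theorem isProbabilityMeasure_pairLaw (hp : p ∈ Set.Icc (0 : ℝ) 1) :
    IsProbabilityMeasure (pairLaw D p) := by
  refine ⟨?_⟩
  simp only [pairLaw, Measure.coe_add, Measure.coe_smul, Pi.add_apply, Pi.smul_apply, measure_univ,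
    smul_eq_mul, mul_one]
  rw [← ENNReal.ofReal_add (by linarith [hp.2]) hp.1]
  simp

theorem ae_pairLaw {q : Fin 2 × EuclideanSpace ℝ (Fin d) → Prop} (hq : MeasurableSet {y | q y})
    (h : ∀ a, ∀ᵐ x ∂(D a), q (a, x)) : ∀ᵐ y ∂(pairLaw D p), q y := by
  have h' (a : Fin 2) : ∀ᵐ y ∂(ENNReal.ofReal (groupProb p a) • (D a).map (Prod.mk a)), q y :=
    Measure.ae_smul_measure ((ae_map_iff measurable_prodMk_left.aemeasurable hq).2 (h a)) _
  rw [pairLaw_eq_sum, Fin.sum_univ_two, ae_add_measure_iff]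
  exact ⟨h' 0, h' 1⟩

theorem integral_pairLaw (hp : p ∈ Set.Icc (0 : ℝ) 1)
    {f : Fin 2 × EuclideanSpace ℝ (Fin d) → ℝ} (hf : Measurable f)
    (hint : ∀ a, Integrable (fun x => f (a, x)) (D a)) :
    ∫ y, f y ∂(pairLaw D p) = ∑ a, groupProb p a * ∫ x, f (a, x) ∂(D a) := by
  have h (a : Fin 2) :
      Integrable f (ENNReal.ofReal (groupProb p a) • (D a).map (Prod.mk a)) :=
    ((integrable_map_measure hf.aestronglyMeasurable measurable_prodMk_left.aemeasurable).2
      (hint a)).smul_measure ENNReal.ofReal_ne_top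
  rw [pairLaw_eq_sum, integral_finsetSum_measure fun a _ => h a]
  refine Finset.sum_congr rfl fun a _ => ?_
  have h0 : 0 ≤ groupProb p a := by
    unfold groupProb
    split_ifs <;> linarith [hp.1, hp.2]
  rw [integral_smul_measure, integral_map measurable_prodMk_left.aemeasurable
    hf.aestronglyMeasurable, ENNReal.toReal_ofReal h0, smul_eq_mul]

theorem integral_groupInd_mul (hp : p ∈ Set.Icc (0 : ℝ) 1) (a : Fin 2)
    {g : EuclideanSpace ℝ (Fin d) → ℝ} (hg : Measurable g) (hint : Integrable g (D a)) :
    ∫ y, groupInd a y * g y.2 ∂(pairLaw D p) = groupProb p a * ∫ x, g x ∂(D a) := by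
  rw [integral_pairLaw (f := fun y => groupInd a y * g y.2) hp
    ((measurable_groupInd a).mul (hg.comp measurable_snd)),
    Finset.sum_eq_single a]
  · simp [groupInd]
  · intro b _ hb
    simp [groupInd, hb]
  · simp
  · intro b
    by_cases hb : b = a
    · subst hb
      simpa [groupInd] using hint
    · simp [groupInd, hb]

/-- Conjugation by `B` costs at most `β` in norm and `β²` in second moment. The indicator is
idempotent, so the second moment gains one factor `groupProb p a`; hence the effective sample size
is the mean group size. It is used with `B = 1` and with `B = [P W]`. -/
theorem isCenteredContraction_groupDev (hp : p ∈ Set.Icc (0 : ℝ) 1) {K V β θ : ℝ} (a : Fin 2)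
    (hK : ∀ᵐ x ∂(D a), ‖outerDev (D a) x‖ ≤ K) (hV : outerVariance (D a) ≤ V)
    {B : Matrix (Fin d) (Fin n) ℝ} (hB : ‖B‖ ^ 2 ≤ β) (hV0 : 0 ≤ V) (hθ : 0 ≤ θ)
    (hθK : θ * (β * K) ≤ 1) :
    IsCenteredContraction (pairLaw D p) (θ ^ 2 * (β ^ 2 * (groupProb p a * V)))
      fun y => θ • (Bᵀ * groupDev D a y * B) where
  measurable := ((measurable_sandwich B B).comp (measurable_groupDev a)).const_smul θ
  symm y := by
    simp only [groupDev, transpose_smul, transpose_mul, transpose_transpose, outerDev_transpose,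
      Matrix.mul_assoc]
  norm_le := by
    refine ae_pairLaw (measurableSet_le
      (((measurable_sandwich B B).comp (measurable_groupDev a)).const_smul θ).norm
      measurable_const) fun b => ?_
    by_cases hb : b = a
    · subst hb
      filter_upwards [hK] with x hx
      simp only [groupDev, groupInd, if_true, one_smul, norm_smul, Real.norm_of_nonneg hθ]
      refine le_trans (mul_le_mul_of_nonneg_left ?_ hθ) hθK
      calc ‖Bᵀ * outerDev (D b) x * B‖ ≤ ‖Bᵀ‖ * ‖outerDev (D b) x‖ * ‖B‖ :=
            (l2_opNorm_mul _ _).trans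
              (mul_le_mul_of_nonneg_right (l2_opNorm_mul _ _) (norm_nonneg _))
        _ = ‖B‖ ^ 2 * ‖outerDev (D b) x‖ := by rw [norm_transpose_eq]; ring
        _ ≤ β * K := mul_le_mul hB hx (norm_nonneg _) ((sq_nonneg _).trans hB)
    · simp [groupDev, groupInd, hb]
  mean i j := by
    have h : ∀ y : Fin 2 × EuclideanSpace ℝ (Fin d),
        (θ • (Bᵀ * groupDev D a y * B)) i j =
          groupInd a y * ∑ l, ∑ k, (θ * B k i * B l j) * outerDev (D a) y.2 k l := by
      intro y
      rw [groupDev, Matrix.mul_smul, Matrix.smul_mul]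
      simp only [Matrix.smul_apply, mul_apply, transpose_apply, smul_eq_mul, Finset.mul_sum,
        Finset.sum_mul]
      refine Finset.sum_congr rfl fun l _ => Finset.sum_congr rfl fun k _ => by ring
    have hint (k l : Fin d) :
        Integrable (fun x => (θ * B k i * B l j) * outerDev (D a) x k l) (D a) :=
      (integrable_outerDev hK k l).const_mul _
    have hmeas (k l : Fin d) : Measurable fun x => outerDev (D a) x k l :=
      measurable_matrix_iff.1 (measurable_outerDev (D a)) k l
    simp only [h]
    rw [integral_groupInd_mul hp a
      (g := fun x => ∑ l, ∑ k, (θ * B k i * B l j) * outerDev (D a) x k l) (by fun_prop)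
      (integrable_finsetSum _ fun l _ => integrable_finsetSum _ fun k _ => hint k l),
      integral_finsetSum _ fun l _ => integrable_finsetSum _ fun k _ => hint k l]
    refine mul_eq_zero_of_right _ (Finset.sum_eq_zero fun l _ => ?_)
    rw [integral_finsetSum _ fun k _ => hint k l]
    refine Finset.sum_eq_zero fun k _ => ?_
    rw [integral_const_mul, integral_outerDev hK, mul_zero]
  variance u := by
    have hβ : 0 ≤ β := (sq_nonneg _).trans hB
    have hP : 0 ≤ groupProb p a := by
      unfold groupProb
      split_ifs <;> linarith [hp.1, hp.2]
    have hu : 0 ≤ u ⬝ᵥ u := Finset.sum_nonneg fun i _ => mul_self_nonneg _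
    set w := B *ᵥ u with hw
    have hwu : w ⬝ᵥ w ≤ β * (u ⬝ᵥ u) :=
      (dotProduct_mulVec_self_le B u).trans (mul_le_mul_of_nonneg_right hB hu)
    set g : EuclideanSpace ℝ (Fin d) → ℝ := fun x =>
      θ ^ 2 * ((Bᵀ *ᵥ (outerDev (D a) x *ᵥ w)) ⬝ᵥ (Bᵀ *ᵥ (outerDev (D a) x *ᵥ w))) with hg
    have hgle (x : EuclideanSpace ℝ (Fin d)) :
        g x ≤ θ ^ 2 * (β * ((outerDev (D a) x *ᵥ w) ⬝ᵥ (outerDev (D a) x *ᵥ w))) := by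
      refine mul_le_mul_of_nonneg_left ((dotProduct_mulVec_self_le _ _).trans
        (mul_le_mul_of_nonneg_right ?_ (Finset.sum_nonneg fun i _ => mul_self_nonneg _)))
        (sq_nonneg _)
      rwa [norm_transpose_eq]
    have hg0 (x : EuclideanSpace ℝ (Fin d)) : 0 ≤ g x :=
      mul_nonneg (sq_nonneg _) (Finset.sum_nonneg fun i _ => mul_self_nonneg _)
    have hmeas (k l : Fin d) : Measurable fun x => outerDev (D a) x k l :=
      measurable_matrix_iff.1 (measurable_outerDev (D a)) k l
    have hgm : Measurable g := by
      simp only [hg, dotProduct, mulVec]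
      fun_prop
    have hint2 := ((integrable_outerDev_mulVec hK w).const_mul β).const_mul (θ ^ 2)
    have hgint : Integrable g (D a) := by
      refine hint2.mono' hgm.aestronglyMeasurable (ae_of_all _ fun x => ?_)
      rw [Real.norm_of_nonneg (hg0 x)]
      exact hgle x
    have h : ∀ y : Fin 2 × EuclideanSpace ℝ (Fin d),
        ((θ • (Bᵀ * groupDev D a y * B)) *ᵥ u) ⬝ᵥ ((θ • (Bᵀ * groupDev D a y * B)) *ᵥ u) =
          groupInd a y * g y.2 := by
      intro y
      have hi : groupInd a y * groupInd a y = groupInd a y := by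
        unfold groupInd
        split_ifs <;> simp
      simp only [groupDev, hg, hw, smul_mulVec, ← mulVec_mulVec, mulVec_smul, smul_dotProduct,
        dotProduct_smul, smul_eq_mul]
      linear_combination (θ ^ 2 * ((Bᵀ *ᵥ (outerDev (D a) y.2 *ᵥ w)) ⬝ᵥ
        (Bᵀ *ᵥ (outerDev (D a) y.2 *ᵥ w)))) * hi
    simp only [h]
    rw [integral_groupInd_mul hp a hgm hgint]
    have hfin : ∫ x, g x ∂(D a) ≤ θ ^ 2 * (β * (V * (β * (u ⬝ᵥ u)))) := by
      refine (integral_mono hgint hint2 hgle).trans ?_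
      rw [integral_const_mul, integral_const_mul]
      gcongr
      exact (integral_outerDev_mulVec_le hK hV w).trans (mul_le_mul_of_nonneg_left hwu hV0)
    calc groupProb p a * ∫ x, g x ∂(D a)
        ≤ groupProb p a * (θ ^ 2 * (β * (V * (β * (u ⬝ᵥ u))))) :=
          mul_le_mul_of_nonneg_left hfin hP
      _ = _ := by ring

/-- Group counts are treated as `1 × 1` matrices, so that the matrix tail bound also serves as a
Chernoff bound. The Bernoulli variance `q (1 - q)` is bounded by `q`. -/
theorem isCenteredContraction_groupInd (hp : p ∈ Set.Icc (0 : ℝ) 1) (a : Fin 2) {θ : ℝ}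
    (hθ : 0 ≤ θ) (hθ1 : θ ≤ 1) :
    IsCenteredContraction (pairLaw D p) (θ ^ 2 * groupProb p a) fun y =>
      (θ * (groupInd a y - groupProb p a)) • (1 : Matrix (Fin 1) (Fin 1) ℝ) := by
  have hprob := isProbabilityMeasure_pairLaw (D := D) hp
  have hq : groupProb p a ∈ Set.Icc (0 : ℝ) 1 := by
    unfold groupProb
    split_ifs <;> constructor <;> linarith [hp.1, hp.2]
  have hm : Measurable fun y : Fin 2 × EuclideanSpace ℝ (Fin d) =>
      θ * (groupInd a y - groupProb p a) :=
    ((measurable_groupInd a).sub_const _).const_mul _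
  have hind : ∫ y, groupInd a y ∂(pairLaw D p) = groupProb p a := by
    simpa using integral_groupInd_mul (D := D) hp a (g := fun _ => 1) measurable_const
      (integrable_const _)
  have hindint : Integrable (groupInd a) (pairLaw D p) := by
    refine Integrable.of_bound (measurable_groupInd a).aestronglyMeasurable 1
      (ae_of_all _ fun y => ?_)
    unfold groupInd
    split_ifs <;> simp
  refine ⟨hm.smul_const _, fun y => by simp, ae_of_all _ fun y => ?_, fun i j => ?_, fun u => ?_⟩
  · have h1 : ‖(1 : Matrix (Fin 1) (Fin 1) ℝ)‖ ≤ 1 :=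
      norm_le_one_of_transpose_mul_self (by simp)
    have h2 : |groupInd a y - groupProb p a| ≤ 1 := by
      unfold groupInd
      split_ifs <;> rw [abs_le] <;> constructor <;> linarith [hq.1, hq.2]
    rw [norm_smul, norm_mul, Real.norm_of_nonneg hθ, Real.norm_eq_abs]
    exact mul_le_one₀ (mul_le_one₀ hθ1 (abs_nonneg _) h2) (norm_nonneg _) h1
  · simp only [Matrix.smul_apply, smul_eq_mul]
    rw [integral_mul_const, integral_const_mul, integral_sub hindint (integrable_const _), hind]
    simp
  · have hu : 0 ≤ u ⬝ᵥ u := Finset.sum_nonneg fun i _ => mul_self_nonneg _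
    have h : ∀ y : Fin 2 × EuclideanSpace ℝ (Fin d),
        (((θ * (groupInd a y - groupProb p a)) • (1 : Matrix (Fin 1) (Fin 1) ℝ)) *ᵥ u) ⬝ᵥ
          (((θ * (groupInd a y - groupProb p a)) • (1 : Matrix (Fin 1) (Fin 1) ℝ)) *ᵥ u) =
        (θ ^ 2 * (u ⬝ᵥ u)) * (groupInd a y * (1 - 2 * groupProb p a) + groupProb p a ^ 2) := by
      intro y
      have hi : groupInd a y * groupInd a y = groupInd a y := by
        unfold groupInd
        split_ifs <;> simp
      simp only [smul_mulVec, one_mulVec, smul_dotProduct, dotProduct_smul, smul_eq_mul]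
      linear_combination (θ ^ 2 * (u ⬝ᵥ u)) * hi
    simp only [h]
    rw [integral_const_mul, integral_add (hindint.mul_const _) (integrable_const _),
      integral_mul_const, hind, integral_const, probReal_univ, one_smul]
    have : 0 ≤ (θ ^ 2 * (u ⬝ᵥ u)) * groupProb p a ^ 2 := by positivity
    linarith

end PairLaw

/-! ### Bernstein bounds for one group -/

section Concentration

open Matrix

variable {d n : ℕ} {D : Fin 2 → Measure (EuclideanSpace ℝ (Fin d))} {p : ℝ}
variable {Ω : Type*} [MeasurableSpace Ω] {μ : Measure Ω}

theorem IsCenteredContraction.comp_measurePreserving {α : Type*} [MeasurableSpace α]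
    {ρ : Measure α} {v : ℝ} {Z : α → Matrix (Fin n) (Fin n) ℝ} (hZ : IsCenteredContraction ρ v Z)
    {X : Ω → α} (hX : MeasurePreserving X μ ρ) : IsCenteredContraction μ v fun ω => Z (X ω) where
  measurable := hZ.measurable.comp hX.measurable
  symm ω := hZ.symm _
  norm_le := hX.quasiMeasurePreserving.ae hZ.norm_le
  mean i j := by
    rw [← hZ.mean i j, ← hX.map_eq, integral_map hX.measurable.aemeasurable
      (measurable_matrix_iff.1 hZ.measurable i j).aestronglyMeasurable]
  variance u := by
    have hm : Measurable fun y => (Z y *ᵥ u) ⬝ᵥ (Z y *ᵥ u) := by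
      have := measurable_matrix_iff.1 hZ.measurable
      simp only [dotProduct, mulVec]
      fun_prop
    have h := hZ.variance u
    rwa [← hX.map_eq, integral_map hX.measurable.aemeasurable hm.aestronglyMeasurable] at h

theorem groupProb_mem_Icc (hp : p ∈ Set.Icc (0 : ℝ) 1) (a : Fin 2) :
    groupProb p a ∈ Set.Icc (0 : ℝ) 1 := by
  unfold groupProb
  split_ifs <;> constructor <;> linarith [hp.1, hp.2]

variable [∀ a, IsProbabilityMeasure (D a)] {ι : Type*} [IsProbabilityMeasure μ]

/-- A **matrix Bernstein inequality** for the sums of the centred contributions of one group. -/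
theorem measure_le_norm_sum_groupDev_le (hn : 0 < n) (hp : p ∈ Set.Icc (0 : ℝ) 1) {K V β r κ : ℝ}
    (a : Fin 2) (hK : ∀ᵐ x ∂(D a), ‖outerDev (D a) x‖ ≤ K) (hV : outerVariance (D a) ≤ V)
    {B : Matrix (Fin d) (Fin n) ℝ} (hB : ‖B‖ ^ 2 ≤ β) (hK0 : 0 < K) (hV0 : 0 < V) (hβ : 0 < β)
    (hr : 0 ≤ r) {X : ι → Ω → Fin 2 × EuclideanSpace ℝ (Fin d)}
    (hX : ∀ i, MeasurePreserving (X i) μ (pairLaw D p)) (hind : iIndepFun X μ) (s : Finset ι)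
    (h1 : 2 * (β * K) * κ ≤ s.card * groupProb p a * r)
    (h2 : 4 * (β ^ 2 * V) * κ ≤ s.card * groupProb p a * r ^ 2) :
    μ {ω | s.card * groupProb p a * r ≤ ‖∑ i ∈ s, Bᵀ * groupDev D a (X i ω) * B‖} ≤
      ENNReal.ofReal (2 * n * Real.exp (-κ)) := by
  set T : ℝ := s.card * groupProb p a with hT
  have hT0 : 0 ≤ T := mul_nonneg (Nat.cast_nonneg _) (groupProb_mem_Icc hp a).1
  -- The second term minimises the exponent `T β² V θ² - θ T r`; the first keeps the rescaled
  -- summands in the unit ball. Under either cap the quadratic part is at most half of the linear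
  -- one, leaving `-θ T r / 2 ≤ -κ`.
  set θ : ℝ := min (1 / (β * K)) (r / (2 * (β ^ 2 * V))) with hθ
  have hβK : 0 < β * K := mul_pos hβ hK0
  have hβV : 0 < β ^ 2 * V := by positivity
  have hθ0 : 0 ≤ θ := le_min (by positivity) (by positivity)
  have hθK : θ * (β * K) ≤ 1 := by
    rw [← le_div_iff₀ hβK]
    exact min_le_left _ _
  have hθV : θ * (2 * (β ^ 2 * V)) ≤ r := by
    rw [← le_div_iff₀ (by positivity)]
    exact min_le_right _ _
  have hκ : 2 * κ ≤ θ * (T * r) := by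
    rcases min_choice (1 / (β * K)) (r / (2 * (β ^ 2 * V))) with h | h
    · rw [hθ, h, div_mul_eq_mul_div, le_div_iff₀ hβK]
      linarith
    · rw [hθ, h, div_mul_eq_mul_div, le_div_iff₀ (by positivity)]
      linarith
  have hZ := isCenteredContraction_groupDev hp a hK hV hB hV0.le hθ0 hθK
  have hb := measure_le_norm_sum_le hn (fun i => hZ.comp_measurePreserving (hX i))
    (hind.comp (fun _ y => θ • (Bᵀ * groupDev D a y * B)) fun _ => hZ.measurable) s (θ * (T * r))
  refine (measure_mono fun ω hω => ?_).trans (hb.trans (ENNReal.ofReal_le_ofReal ?_))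
  · change θ * (T * r) ≤ ‖∑ i ∈ s, θ • (Bᵀ * groupDev D a (X i ω) * B)‖
    rw [← Finset.smul_sum, norm_smul, Real.norm_of_nonneg hθ0]
    exact mul_le_mul_of_nonneg_left hω hθ0
  · refine mul_le_mul_of_nonneg_left (Real.exp_le_exp.2 ?_) (by positivity)
    have h3 : (s.card : ℝ) * (θ ^ 2 * (β ^ 2 * (groupProb p a * V))) =
        θ * T * (θ * (2 * (β ^ 2 * V))) / 2 := by rw [hT]; ring
    have h4 : θ * T * (θ * (2 * (β ^ 2 * V))) ≤ θ * T * r :=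
      mul_le_mul_of_nonneg_left hθV (mul_nonneg hθ0 hT0)
    rw [h3]
    linarith

theorem measure_le_abs_sum_groupInd_sub_le (hp : p ∈ Set.Icc (0 : ℝ) 1) {κ : ℝ} (a : Fin 2)
    {X : ι → Ω → Fin 2 × EuclideanSpace ℝ (Fin d)}
    (hX : ∀ i, MeasurePreserving (X i) μ (pairLaw D p)) (hind : iIndepFun X μ) (s : Finset ι)
    (h1 : 16 * κ ≤ s.card * groupProb p a) :
    μ {ω | s.card * groupProb p a / 2 ≤
        |∑ i ∈ s, groupInd a (X i ω) - s.card * groupProb p a|} ≤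
      ENNReal.ofReal (2 * Real.exp (-κ)) := by
  -- With mean count `T`, the scale `1 / 4` gives the exponent `T / 16 - T / 8 = -T / 16`, whence
  -- the `16` in `h1`.
  have hZ := isCenteredContraction_groupInd (D := D) hp a (θ := 1 / 4) (by norm_num) (by norm_num)
  have hb := measure_le_norm_sum_le one_pos (fun i => hZ.comp_measurePreserving (hX i))
    (hind.comp (fun _ y => ((1 / 4 : ℝ) * (groupInd a y - groupProb p a)) •
      (1 : Matrix (Fin 1) (Fin 1) ℝ)) fun _ => hZ.measurable) s (s.card * groupProb p a / 8)
  refine (measure_mono fun ω hω => ?_).trans (hb.trans (ENNReal.ofReal_le_ofReal ?_))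
  · rw [Set.mem_ofPred_eq] at hω ⊢
    rw [← Finset.sum_smul, ← Finset.mul_sum, Finset.sum_sub_distrib, Finset.sum_const, nsmul_eq_mul]
    refine le_trans ?_ (abs_apply_le_norm _ 0 0)
    rw [Matrix.smul_apply, Matrix.one_apply_eq, smul_eq_mul, mul_one, abs_mul,
      abs_of_pos (by norm_num : (0 : ℝ) < 1 / 4)]
    linarith
  · rw [Nat.cast_one, mul_one]
    refine mul_le_mul_of_nonneg_left (Real.exp_le_exp.2 ?_) (by norm_num)
    linarith

end Concentration

/-! ### Compression to the columns of `[P W]` -/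

section Selectors

open Matrix

/-- The `2m × m` matrix whose columns are the standard basis vectors selected by `f`. -/
def selector {m k : ℕ} (f : Fin m → Fin k) : Matrix (Fin k) (Fin m) ℝ :=
  of fun i j => if i = f j then 1 else 0

variable {d m k : ℕ}

theorem selector_transpose_mul_selector (f g : Fin m → Fin k) :
    (selector f)ᵀ * selector g = of fun i j => if f i = g j then 1 else 0 := by
  ext i j
  simp [selector, mul_apply, eq_comm]

theorem selector_transpose_mul_self {f : Fin m → Fin k} (hf : Function.Injective f) :
    (selector f)ᵀ * selector f = 1 := by
  rw [selector_transpose_mul_selector]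
  ext i j
  simp [one_apply, hf.eq_iff]

theorem selector_transpose_mul_of_ne {f g : Fin m → Fin k} (h : ∀ i j, f i ≠ g j) :
    (selector f)ᵀ * selector g = 0 := by
  rw [selector_transpose_mul_selector]
  ext i j
  simp [h]

/-- The isometric embedding of the first `m` coordinates. -/
def inlMatrix (m : ℕ) : Matrix (Fin (m + m)) (Fin m) ℝ := selector (Fin.castAdd m)

/-- The isometric embedding of the last `m` coordinates. -/
def inrMatrix (m : ℕ) : Matrix (Fin (m + m)) (Fin m) ℝ := selector (Fin.natAdd m)

theorem inlMatrix_transpose_mul_self : (inlMatrix m)ᵀ * inlMatrix m = 1 :=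
  selector_transpose_mul_self (Fin.castAdd_injective m m)

theorem inrMatrix_transpose_mul_self : (inrMatrix m)ᵀ * inrMatrix m = 1 :=
  selector_transpose_mul_self (Fin.natAdd_injective m m)

theorem inrMatrix_transpose_mul_inlMatrix : (inrMatrix m)ᵀ * inlMatrix m = 0 :=
  selector_transpose_mul_of_ne fun i j h => by
    have := congrArg Fin.val h
    simp at this
    omega

theorem inlMatrix_transpose_mul_inrMatrix : (inlMatrix m)ᵀ * inrMatrix m = 0 :=
  selector_transpose_mul_of_ne fun i j h => by
    have := congrArg Fin.val h
    simp at this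
    omega

/-- The `d × 2m` matrix `[P W]`. -/
def appendCols (P W : Matrix (Fin d) (Fin m) ℝ) : Matrix (Fin d) (Fin (m + m)) ℝ :=
  P * (inlMatrix m)ᵀ + W * (inrMatrix m)ᵀ

theorem norm_appendCols_sq_le {P W : Matrix (Fin d) (Fin m) ℝ} (hP : Pᵀ * P = 1)
    (hW : Wᵀ * W = 1) : ‖appendCols P W‖ ^ 2 ≤ 4 := by
  have h1 : ‖P‖ ≤ 1 := norm_le_one_of_transpose_mul_self hP
  have h2 : ‖W‖ ≤ 1 := norm_le_one_of_transpose_mul_self hW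
  have h3 : ‖inlMatrix m‖ ≤ 1 := norm_le_one_of_transpose_mul_self inlMatrix_transpose_mul_self
  have h4 : ‖inrMatrix m‖ ≤ 1 := norm_le_one_of_transpose_mul_self inrMatrix_transpose_mul_self
  have h5 : ‖appendCols P W‖ ≤ 1 * 1 + 1 * 1 := by
    refine (norm_add_le _ _).trans (add_le_add ((l2_opNorm_mul _ _).trans ?_)
      ((l2_opNorm_mul _ _).trans ?_)) <;> rw [norm_transpose_eq] <;> gcongr
  nlinarith [norm_nonneg (appendCols P W)]

/-- The left matrix is an off-diagonal block of the right one. The latter is symmetric whenever `A`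
is, so the symmetric Bernstein bound applies in dimension `2m`. -/
theorem norm_transpose_mul_mul_le (P W : Matrix (Fin d) (Fin m) ℝ) (A : Matrix (Fin d) (Fin d) ℝ) :
    ‖Pᵀ * A * W‖ ≤ ‖(appendCols P W)ᵀ * A * appendCols P W‖ := by
  set Q := appendCols P W with hQ
  have hP : Q * inlMatrix m = P := by
    rw [hQ, appendCols, Matrix.add_mul, Matrix.mul_assoc, Matrix.mul_assoc,
      inlMatrix_transpose_mul_self, inrMatrix_transpose_mul_inlMatrix, Matrix.mul_one,
      Matrix.mul_zero, add_zero]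
  have hW : Q * inrMatrix m = W := by
    rw [hQ, appendCols, Matrix.add_mul, Matrix.mul_assoc, Matrix.mul_assoc,
      inrMatrix_transpose_mul_self, inlMatrix_transpose_mul_inrMatrix, Matrix.mul_one,
      Matrix.mul_zero, zero_add]
  have h3 : ‖inlMatrix m‖ ≤ 1 := norm_le_one_of_transpose_mul_self inlMatrix_transpose_mul_self
  have h4 : ‖inrMatrix m‖ ≤ 1 := norm_le_one_of_transpose_mul_self inrMatrix_transpose_mul_self
  have h : Pᵀ * A * W = (inlMatrix m)ᵀ * (Qᵀ * A * Q) * inrMatrix m := by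
    conv_lhs => rw [← hP, ← hW]
    simp only [transpose_mul, Matrix.mul_assoc]
  rw [h]
  calc ‖(inlMatrix m)ᵀ * (Qᵀ * A * Q) * inrMatrix m‖
      ≤ ‖(inlMatrix m)ᵀ‖ * ‖Qᵀ * A * Q‖ * ‖inrMatrix m‖ :=
        (l2_opNorm_mul _ _).trans (mul_le_mul_of_nonneg_right (l2_opNorm_mul _ _) (norm_nonneg _))
    _ ≤ 1 * ‖Qᵀ * A * Q‖ * 1 := by
        rw [norm_transpose_eq]
        gcongr
    _ = ‖Qᵀ * A * Q‖ := by ring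

end Selectors

/-! ### The noise matrix as a normalised centred sum -/

section Noise

open Matrix

variable {d m : ℕ}

theorem card_groupIndices (b : ℕ) (s : ℕ → Fin 2 × EuclideanSpace ℝ (Fin d)) (t : ℕ) (a : Fin 2) :
    ((groupIndices b s t a).card : ℝ) =
      ∑ i ∈ Finset.Ioc ((t - 1) * b) (t * b), groupInd a (s i) := by
  simp [groupIndices, groupInd, Finset.sum_boole]

theorem groupAverage_eq (b : ℕ) (s : ℕ → Fin 2 × EuclideanSpace ℝ (Fin d)) (t : ℕ) (a : Fin 2)
    (W : Matrix (Fin d) (Fin m) ℝ) :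
    groupAverage b s t a W = (∑ i ∈ Finset.Ioc ((t - 1) * b) (t * b), groupInd a (s i))⁻¹ •
      ∑ i ∈ Finset.Ioc ((t - 1) * b) (t * b), groupInd a (s i) • (outer (s i).2 * W) := by
  rw [groupAverage, card_groupIndices, groupIndices, Finset.sum_filter]
  congr 1
  refine Finset.sum_congr rfl fun i _ => ?_
  unfold groupInd
  split_ifs <;> simp

theorem groupAverage_sub (D : Fin 2 → Measure (EuclideanSpace ℝ (Fin d))) (b : ℕ)
    (s : ℕ → Fin 2 × EuclideanSpace ℝ (Fin d)) (t : ℕ) (a : Fin 2) (W : Matrix (Fin d) (Fin m) ℝ)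
    (h : ∑ i ∈ Finset.Ioc ((t - 1) * b) (t * b), groupInd a (s i) ≠ 0) :
    groupAverage b s t a W - secondMoment (D a) * W =
      (∑ i ∈ Finset.Ioc ((t - 1) * b) (t * b), groupInd a (s i))⁻¹ •
        ((∑ i ∈ Finset.Ioc ((t - 1) * b) (t * b), groupDev D a (s i)) * W) := by
  rw [groupAverage_eq]
  set I := Finset.Ioc ((t - 1) * b) (t * b)
  have h1 : (∑ i ∈ I, groupDev D a (s i)) * W = ∑ i ∈ I, groupInd a (s i) • (outer (s i).2 * W) -
      (∑ i ∈ I, groupInd a (s i)) • (secondMoment (D a) * W) := by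
    rw [Finset.sum_smul, ← Finset.sum_sub_distrib, Matrix.sum_mul]
    refine Finset.sum_congr rfl fun i _ => ?_
    rw [groupDev, outerDev, Matrix.smul_mul, Matrix.sub_mul, smul_sub]
  rw [h1, smul_sub, smul_smul, inv_mul_cancel₀ h, one_smul]

/-- Here `N > T / 2`, so replacing the mean count by the actual one costs a factor `2`; the two
groups together give the `4` in `norm_noise_le`. -/
theorem norm_smul_le_of_concentrated {k l : Type*} [Fintype k] [Fintype l] [DecidableEq k]
    [DecidableEq l] {N T r : ℝ} {A : Matrix k l ℝ} (hT : 0 < T) (hN : |N - T| < T / 2)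
    (hA : ‖A‖ ≤ T * r) : ‖N⁻¹ • A‖ ≤ 2 * r := by
  have hN' : T / 2 < N := by linarith [(abs_lt.1 hN).1]
  have hN0 : 0 < N := by linarith
  have hr : 0 ≤ r := nonneg_of_mul_nonneg_right ((norm_nonneg _).trans hA) hT
  rw [norm_smul, Real.norm_of_nonneg (by positivity), inv_mul_le_iff₀ hN0]
  nlinarith

variable (D : Fin 2 → Measure (EuclideanSpace ℝ (Fin d)))

/-- The deterministic part of the argument: on the event that the group sizes and the sums of the
centred contributions of both groups are close to their means, the noise matrix is small. -/
theorem norm_noise_le {qr : Matrix (Fin d) (Fin m) ℝ → Matrix (Fin d) (Fin m) ℝ} {b : ℕ}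
    {g : Matrix (Fin d) (Fin m) ℝ} {s : ℕ → Fin 2 × EuclideanSpace ℝ (Fin d)} {t : ℕ}
    {T : Fin 2 → ℝ} {r r' : ℝ} (P : Matrix (Fin d) (Fin m) ℝ) (hT : ∀ a, 0 < T a)
    (hW : ‖iterate qr b g s (t - 1)‖ ≤ 1)
    (h1 : ∀ a, |∑ i ∈ Finset.Ioc ((t - 1) * b) (t * b), groupInd a (s i) - T a| < T a / 2)
    (h2 : ∀ a, ‖∑ i ∈ Finset.Ioc ((t - 1) * b) (t * b), groupDev D a (s i)‖ ≤ T a * r)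
    (h3 : ∀ a, ‖Pᵀ * (∑ i ∈ Finset.Ioc ((t - 1) * b) (t * b), groupDev D a (s i)) *
      iterate qr b g s (t - 1)‖ ≤ T a * r') :
    ‖noise qr b (momentGap D) g s t‖ ≤ 4 * r ∧ ‖Pᵀ * noise qr b (momentGap D) g s t‖ ≤ 4 * r' := by
  set W := iterate qr b g s (t - 1) with hWdef
  have hne (a : Fin 2) : ∑ i ∈ Finset.Ioc ((t - 1) * b) (t * b), groupInd a (s i) ≠ 0 := by
    have := (abs_lt.1 (h1 a)).1
    have := hT a
    intro h
    linarith
  have hnoise : noise qr b (momentGap D) g s t =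
      (groupAverage b s t 1 W - secondMoment (D 1) * W) -
        (groupAverage b s t 0 W - secondMoment (D 0) * W) := by
    rw [noise, momentGap, Matrix.sub_mul]
    abel
  rw [hnoise, Matrix.mul_sub]
  constructor
  · have h (a : Fin 2) : ‖groupAverage b s t a W - secondMoment (D a) * W‖ ≤ 2 * r := by
      rw [groupAverage_sub D b s t a W (hne a)]
      refine norm_smul_le_of_concentrated (hT a) (h1 a) ((l2_opNorm_mul _ _).trans ?_)
      exact (mul_le_of_le_one_right (norm_nonneg _) hW).trans (h2 a)
    linarith [norm_sub_le (groupAverage b s t 1 W - secondMoment (D 1) * W)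
      (groupAverage b s t 0 W - secondMoment (D 0) * W), h 0, h 1]
  · have h (a : Fin 2) : ‖Pᵀ * (groupAverage b s t a W - secondMoment (D a) * W)‖ ≤ 2 * r' := by
      rw [groupAverage_sub D b s t a W (hne a), Matrix.mul_smul, ← Matrix.mul_assoc]
      exact norm_smul_le_of_concentrated (hT a) (h1 a) (h3 a)
    linarith [norm_sub_le (Pᵀ * (groupAverage b s t 1 W - secondMoment (D 1) * W))
      (Pᵀ * (groupAverage b s t 0 W - secondMoment (D 0) * W)), h 0, h 1]

end Noise

/-! ### Measurability of the iterates and dependence on the past -/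

section Iterates

open Matrix

variable {d m : ℕ} {qr : Matrix (Fin d) (Fin m) ℝ → Matrix (Fin d) (Fin m) ℝ}

theorem iterate_transpose_mul_self (hqr : IsQRRoutine qr) (b : ℕ) (g : Matrix (Fin d) (Fin m) ℝ)
    (s : ℕ → Fin 2 × EuclideanSpace ℝ (Fin d)) (k : ℕ) :
    (iterate qr b g s k)ᵀ * iterate qr b g s k = 1 := by
  cases k with
  | zero => exact hqr.orthonormal _
  | succ k => exact hqr.orthonormal _

theorem groupAverage_congr {b : ℕ} {s s' : ℕ → Fin 2 × EuclideanSpace ℝ (Fin d)} {t : ℕ}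
    (h : ∀ i ∈ Finset.Ioc ((t - 1) * b) (t * b), s i = s' i) (a : Fin 2)
    (W : Matrix (Fin d) (Fin m) ℝ) : groupAverage b s t a W = groupAverage b s' t a W := by
  rw [groupAverage_eq, groupAverage_eq]
  congr 1
  · congr 1
    exact Finset.sum_congr rfl fun i hi => by rw [h i hi]
  · exact Finset.sum_congr rfl fun i hi => by rw [h i hi]

theorem iterate_congr {b : ℕ} (g : Matrix (Fin d) (Fin m) ℝ)
    {s s' : ℕ → Fin 2 × EuclideanSpace ℝ (Fin d)} (k : ℕ) (h : ∀ i ≤ k * b, s i = s' i) :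
    iterate qr b g s k = iterate qr b g s' k := by
  induction k with
  | zero => rfl
  | succ k ih =>
    have hk : k * b ≤ (k + 1) * b := Nat.mul_le_mul_right b k.le_succ
    have hI : ∀ i ∈ Finset.Ioc ((k + 1 - 1) * b) ((k + 1) * b), s i = s' i := fun i hi =>
      h i (Finset.mem_Ioc.1 hi).2
    rw [iterate, iterate, ih fun i hi => h i (hi.trans hk), groupAverage_congr hI,
      groupAverage_congr hI]

theorem measurable_matrix_mul {α : Type*} [MeasurableSpace α] {j k l : ℕ}
    {f : α → Matrix (Fin j) (Fin k) ℝ} {g : α → Matrix (Fin k) (Fin l) ℝ} (hf : Measurable f)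
    (hg : Measurable g) : Measurable fun x => f x * g x := by
  rw [measurable_matrix_iff] at hf hg ⊢
  intro i i'
  simp only [mul_apply]
  exact Finset.measurable_sum _ fun c _ => (hf i c).mul (hg c i')

theorem measurable_matrix_transpose {α : Type*} [MeasurableSpace α] {j k : ℕ}
    {f : α → Matrix (Fin j) (Fin k) ℝ} (hf : Measurable f) : Measurable fun x => (f x)ᵀ := by
  rw [measurable_matrix_iff] at hf ⊢
  exact fun i i' => hf i' i

theorem measurable_groupAverage {α : Type*} [MeasurableSpace α]
    {s : α → ℕ → Fin 2 × EuclideanSpace ℝ (Fin d)} {W : α → Matrix (Fin d) (Fin m) ℝ}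
    (hs : Measurable s) (hW : Measurable W) (b t : ℕ) (a : Fin 2) :
    Measurable fun x => groupAverage b (s x) t a (W x) := by
  have hsi (i : ℕ) : Measurable fun x => s x i := measurable_pi_iff.1 hs i
  have hind (i : ℕ) : Measurable fun x => groupInd a (s x i) :=
    (measurable_groupInd a).comp (hsi i)
  simp only [groupAverage_eq]
  exact (Finset.measurable_sum _ fun i _ => hind i).inv.smul (Finset.measurable_sum _ fun i _ =>
    (hind i).smul (measurable_matrix_mul (measurable_outer.comp (measurable_snd.comp (hsi i))) hW))

theorem measurable_iterate (hqr : IsQRRoutine qr) (b k : ℕ) :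
    Measurable fun q : Matrix (Fin d) (Fin m) ℝ × (ℕ → Fin 2 × EuclideanSpace ℝ (Fin d)) =>
      iterate qr b q.1 q.2 k := by
  induction k with
  | zero => exact hqr.measurable.comp measurable_fst
  | succ k ih =>
    exact hqr.measurable.comp ((measurable_groupAverage measurable_snd ih b (k + 1) 1).sub
      (measurable_groupAverage measurable_snd ih b (k + 1) 0))

end Iterates

/-! ### Regrouping independent variables -/

section Independence

/-- The hypotheses make the joint law a triple product, which is then reassociated. It is applied
with `X = G`, `Y` the past samples and `Z` the current block. -/
theorem IndepFun.prodMk_of_prodMk {Ω α β γ : Type*} [MeasurableSpace Ω] [MeasurableSpace α]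
    [MeasurableSpace β] [MeasurableSpace γ] {μ : Measure Ω} [IsProbabilityMeasure μ] {X : Ω → α}
    {Y : Ω → β} {Z : Ω → γ} (hX : AEMeasurable X μ) (hY : AEMeasurable Y μ) (hZ : AEMeasurable Z μ)
    (h : IndepFun X (fun ω => (Y ω, Z ω)) μ) (hYZ : IndepFun Y Z μ) :
    IndepFun (fun ω => (X ω, Y ω)) Z μ := by
  have hXY : IndepFun X Y μ := h.comp measurable_id measurable_fst
  have := Measure.isProbabilityMeasure_map hX
  have := Measure.isProbabilityMeasure_map hY
  have := Measure.isProbabilityMeasure_map hZ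
  rw [indepFun_iff_map_prod_eq_prod_map_map (hX.prodMk hY) hZ,
    hXY.map_prod_eq_prod_map_map hX hY]
  have h1 := h.map_prod_eq_prod_map_map hX (hY.prodMk hZ)
  rw [hYZ.map_prod_eq_prod_map_map hY hZ, ← Measure.prodAssoc_prod] at h1
  have h2 := congrArg (Measure.map MeasurableEquiv.prodAssoc.symm) h1
  rw [MeasurableEquiv.map_symm_map] at h2
  rw [← h2, AEMeasurable.map_map_of_aemeasurable
    MeasurableEquiv.prodAssoc.symm.measurable.aemeasurable (hX.prodMk (hY.prodMk hZ))]
  rfl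

end Independence

/-! ### Probability of a bad block for a fixed iterate -/

section BadEvent

open Matrix

variable {d m : ℕ} {ι : Type*} [Fintype ι]

/-- The blocks of samples on which the size of some group, or the sum of its centred contributions,
is far from its mean. -/
def badBlocks (D : Fin 2 → Measure (EuclideanSpace ℝ (Fin d))) (P W : Matrix (Fin d) (Fin m) ℝ)
    (T : Fin 2 → ℝ) (r r' : ℝ) : Set (ι → Fin 2 × EuclideanSpace ℝ (Fin d)) :=
  ⋃ a, {y | T a / 2 ≤ |∑ i, groupInd a (y i) - T a|} ∪
    ({y | T a * r ≤ ‖∑ i, groupDev D a (y i)‖} ∪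
      {y | T a * r' ≤ ‖(appendCols P W)ᵀ * (∑ i, groupDev D a (y i)) * appendCols P W‖})

theorem measurableSet_badBlocks (D : Fin 2 → Measure (EuclideanSpace ℝ (Fin d)))
    (P : Matrix (Fin d) (Fin m) ℝ) (T : Fin 2 → ℝ) (r r' : ℝ) :
    MeasurableSet {q : Matrix (Fin d) (Fin m) ℝ × (ι → Fin 2 × EuclideanSpace ℝ (Fin d)) |
      q.1ᵀ * q.1 = 1 ∧ q.2 ∈ badBlocks D P q.1 T r r'} := by
  have hi (i : ι) : Measurable fun q : Matrix (Fin d) (Fin m) ℝ ×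
      (ι → Fin 2 × EuclideanSpace ℝ (Fin d)) => q.2 i :=
    (measurable_pi_apply i).comp measurable_snd
  have hdev (a : Fin 2) : Measurable fun q : Matrix (Fin d) (Fin m) ℝ ×
      (ι → Fin 2 × EuclideanSpace ℝ (Fin d)) => ∑ i, groupDev D a (q.2 i) :=
    Finset.measurable_sum _ fun i _ => (measurable_groupDev a).comp (hi i)
  have hind (a : Fin 2) : Measurable fun q : Matrix (Fin d) (Fin m) ℝ ×
      (ι → Fin 2 × EuclideanSpace ℝ (Fin d)) => |∑ i, groupInd a (q.2 i) - T a| :=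
    ((Finset.measurable_sum _ fun i _ =>
      (measurable_groupInd a).comp (hi i)).sub_const _).abs
  have happ : Measurable fun q : Matrix (Fin d) (Fin m) ℝ ×
      (ι → Fin 2 × EuclideanSpace ℝ (Fin d)) => appendCols P q.1 := by
    have : Continuous fun W : Matrix (Fin d) (Fin m) ℝ => appendCols P W := by
      unfold appendCols
      fun_prop
    exact this.measurable.comp measurable_fst
  have hortho : MeasurableSet {q : Matrix (Fin d) (Fin m) ℝ ×
      (ι → Fin 2 × EuclideanSpace ℝ (Fin d)) | q.1ᵀ * q.1 = 1} := by
    have : IsClosed {W : Matrix (Fin d) (Fin m) ℝ | Wᵀ * W = 1} :=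
      isClosed_eq (by fun_prop) continuous_const
    exact measurable_fst this.measurableSet
  have hbad : MeasurableSet {q : Matrix (Fin d) (Fin m) ℝ ×
      (ι → Fin 2 × EuclideanSpace ℝ (Fin d)) | q.2 ∈ badBlocks D P q.1 T r r'} := by
    have : {q : Matrix (Fin d) (Fin m) ℝ × (ι → Fin 2 × EuclideanSpace ℝ (Fin d)) |
        q.2 ∈ badBlocks D P q.1 T r r'} =
        ⋃ a, {q | T a / 2 ≤ |∑ i, groupInd a (q.2 i) - T a|} ∪
          ({q | T a * r ≤ ‖∑ i, groupDev D a (q.2 i)‖} ∪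
            {q | T a * r' ≤
              ‖(appendCols P q.1)ᵀ * (∑ i, groupDev D a (q.2 i)) * appendCols P q.1‖}) := by
      ext q
      simp [badBlocks]
    rw [this]
    exact MeasurableSet.iUnion fun a => (measurableSet_le measurable_const (hind a)).union
      ((measurableSet_le measurable_const (hdev a).norm).union
        (measurableSet_le measurable_const (measurable_matrix_mul (measurable_matrix_mul
          (measurable_matrix_transpose happ) (hdev a)) happ).norm))
  exact hortho.inter hbad

theorem measure_badBlocks_le {D : Fin 2 → Measure (EuclideanSpace ℝ (Fin d))}
    [∀ a, IsProbabilityMeasure (D a)] {p K V r r' κ κ' δ : ℝ} (hd : 0 < d) (hm : 0 < m)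
    (hp : p ∈ Set.Icc (0 : ℝ) 1) {P W : Matrix (Fin d) (Fin m) ℝ} (hP : Pᵀ * P = 1)
    (hW : Wᵀ * W = 1) (hK : ∀ a, ∀ᵐ x ∂(D a), ‖outerDev (D a) x‖ ≤ K)
    (hV : ∀ a, outerVariance (D a) ≤ V) (hK0 : 0 < K) (hV0 : 0 < V) (hr : 0 ≤ r) (hr' : 0 ≤ r')
    (T : Fin 2 → ℝ) (hT : ∀ a, T a = Fintype.card ι * groupProb p a)
    (hcount : ∀ a, 16 * κ ≤ T a) (h1 : ∀ a, 2 * (1 * K) * κ ≤ T a * r)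
    (h2 : ∀ a, 4 * (1 ^ 2 * V) * κ ≤ T a * r ^ 2) (h3 : ∀ a, 2 * (4 * K) * κ' ≤ T a * r')
    (h4 : ∀ a, 4 * (4 ^ 2 * V) * κ' ≤ T a * r' ^ 2) (hδ : 2 * d * Real.exp (-κ) ≤ δ / 8)
    (hδ' : 2 * (m + m : ℕ) * Real.exp (-κ') ≤ δ / 8) :
    (Measure.pi fun _ : ι => pairLaw D p) (badBlocks D P W T r r') ≤ ENNReal.ofReal δ := by
  have hprob := isProbabilityMeasure_pairLaw (D := D) hp
  have hX (i : ι) : MeasurePreserving (fun y : ι → Fin 2 × EuclideanSpace ℝ (Fin d) => y i)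
      (Measure.pi fun _ : ι => pairLaw D p) (pairLaw D p) :=
    measurePreserving_eval (fun _ : ι => pairLaw D p) i
  have hind : iIndepFun (fun (i : ι) (y : ι → Fin 2 × EuclideanSpace ℝ (Fin d)) => y i)
      (Measure.pi fun _ : ι => pairLaw D p) :=
    iIndepFun_pi (μ := fun _ : ι => pairLaw D p) (X := fun _ y => y) fun _ => aemeasurable_id
  have hδ0 : 0 ≤ δ := by
    have : 0 ≤ 2 * d * Real.exp (-κ) := by positivity
    linarith
  have hone : ‖(1 : Matrix (Fin d) (Fin d) ℝ)‖ ^ 2 ≤ 1 :=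
    pow_le_one₀ (norm_nonneg _) (norm_le_one_of_transpose_mul_self (by simp))
  have hd1 : (1 : ℝ) ≤ d := by exact_mod_cast hd
  have e1 (a : Fin 2) : (Measure.pi fun _ : ι => pairLaw D p)
      {y | T a / 2 ≤ |∑ i, groupInd a (y i) - T a|} ≤ ENNReal.ofReal (δ / 8) := by
    have h := measure_le_abs_sum_groupInd_sub_le hp a hX hind Finset.univ
      (by rw [Finset.card_univ, ← hT]; exact hcount a)
    rw [Finset.card_univ, ← hT] at h
    refine h.trans (ENNReal.ofReal_le_ofReal (le_trans ?_ hδ))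
    nlinarith [Real.exp_pos (-κ)]
  have e2 (a : Fin 2) : (Measure.pi fun _ : ι => pairLaw D p)
      {y | T a * r ≤ ‖∑ i, groupDev D a (y i)‖} ≤ ENNReal.ofReal (δ / 8) := by
    have h := measure_le_norm_sum_groupDev_le hd hp a (hK a) (hV a) hone hK0 hV0 one_pos hr hX hind
      Finset.univ (by rw [Finset.card_univ, ← hT]; exact h1 a)
      (by rw [Finset.card_univ, ← hT]; exact h2 a)
    rw [Finset.card_univ, ← hT] at h
    simp only [transpose_one, one_mul, mul_one] at h
    exact h.trans (ENNReal.ofReal_le_ofReal hδ)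
  have e3 (a : Fin 2) : (Measure.pi fun _ : ι => pairLaw D p)
      {y | T a * r' ≤ ‖(appendCols P W)ᵀ * (∑ i, groupDev D a (y i)) * appendCols P W‖} ≤
        ENNReal.ofReal (δ / 8) := by
    have h := measure_le_norm_sum_groupDev_le (by omega) hp a (hK a) (hV a)
      (norm_appendCols_sq_le hP hW) hK0 hV0 four_pos hr' hX hind
      Finset.univ (by rw [Finset.card_univ, ← hT]; exact h3 a)
      (by rw [Finset.card_univ, ← hT]; exact h4 a)
    rw [Finset.card_univ, ← hT] at h
    simp only [← Matrix.sum_mul, ← Matrix.mul_sum] at h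
    exact h.trans (ENNReal.ofReal_le_ofReal hδ')
  -- Three events for each of two groups, each of probability at most `δ / 8`.
  refine (measure_iUnion_fintype_le _ _).trans ?_
  calc _ ≤ ∑ _a : Fin 2, (ENNReal.ofReal (δ / 8) +
        (ENNReal.ofReal (δ / 8) + ENNReal.ofReal (δ / 8))) :=
        Finset.sum_le_sum fun a _ => (measure_union_le _ _).trans (add_le_add (e1 a)
          ((measure_union_le _ _).trans (add_le_add (e2 a) (e3 a))))
    _ ≤ ENNReal.ofReal δ := by
        have h8 : 0 ≤ δ / 8 := by positivity
        rw [Fin.sum_univ_two, ← ENNReal.ofReal_add h8 h8, ← ENNReal.ofReal_add h8 (by positivity),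
          ← ENNReal.ofReal_add (by positivity) (by positivity)]
        exact ENNReal.ofReal_le_ofReal (by linarith)

end BadEvent

/-! ### Independence of the iterate and the next block -/

section RandomInput

open Matrix

variable {d m : ℕ} {Ω : Type*} [MeasurableSpace Ω] {μ : Measure Ω}
  {D : Fin 2 → Measure (EuclideanSpace ℝ (Fin d))} {p : ℝ} {G : Ω → Matrix (Fin d) (Fin m) ℝ}
  {s : ℕ → Ω → Fin 2 × EuclideanSpace ℝ (Fin d)}

theorem IsRandomInput.aemeasurable_iterate (h : IsRandomInput μ D p G s)
    {qr : Matrix (Fin d) (Fin m) ℝ → Matrix (Fin d) (Fin m) ℝ} (hqr : IsQRRoutine qr) (b k : ℕ) :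
    AEMeasurable (fun ω => iterate qr b (G ω) (fun i => s i ω) k) μ :=
  (measurable_iterate hqr b k).comp_aemeasurable (h.init_law.aemeasurable.prodMk
    (aemeasurable_pi_lambda _ fun i => (h.sample_law i).aemeasurable))

variable [IsProbabilityMeasure μ]

theorem IsRandomInput.map_block (h : IsRandomInput μ D p G s) (I : Finset ℕ) :
    μ.map (fun ω (i : I) => s i ω) = Measure.pi fun _ : I => pairLaw D p := by
  have hind : iIndepFun (fun (i : I) ω => s i ω) μ := h.iid.precomp Subtype.val_injective
  rw [(iIndepFun_iff_map_fun_eq_pi_map fun i : I => (h.sample_law i).aemeasurable).1 hind]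
  congr 1
  ext1 i
  exact (h.sample_law i).map_eq

theorem IsRandomInput.indepFun_iterate_block (h : IsRandomInput μ D p G s)
    {qr : Matrix (Fin d) (Fin m) ℝ → Matrix (Fin d) (Fin m) ℝ} (hqr : IsQRRoutine qr) (b k l : ℕ) :
    IndepFun (fun ω => iterate qr b (G ω) (fun i => s i ω) k)
      (fun ω (i : Finset.Ioc (k * b) l) => s i ω) μ := by
  set I := Finset.Iic (k * b) with hI
  set J := Finset.Ioc (k * b) l with hJ
  have hsm (S : Finset ℕ) : AEMeasurable (fun ω (i : S) => s i ω) μ :=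
    aemeasurable_pi_lambda _ fun i => (h.sample_law i).aemeasurable
  have hdisj : Disjoint I J := by
    rw [Finset.disjoint_left]
    intro i hi hi'
    rw [hI, Finset.mem_Iic] at hi
    rw [hJ, Finset.mem_Ioc] at hi'
    omega
  have hpast := h.iid.indepFun_finset₀ I J hdisj fun i => (h.sample_law i).aemeasurable
  have hG : IndepFun G (fun ω => ((fun i : I => s i ω), fun i : J => s i ω)) μ :=
    h.init_indep.comp measurable_id
      (ψ := fun y : ℕ → Fin 2 × EuclideanSpace ℝ (Fin d) =>
        ((fun i : I => y i), fun i : J => y i)) (by fun_prop)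
  have hind := IndepFun.prodMk_of_prodMk h.init_law.aemeasurable (hsm I) (hsm J) hG hpast
  -- Pads the past with dummy samples; by `iterate_congr` the `k`-th iterate does not see them, so
  -- it is a measurable function of `G` and the past alone.
  set ext : (I → Fin 2 × EuclideanSpace ℝ (Fin d)) → ℕ → Fin 2 × EuclideanSpace ℝ (Fin d) :=
    fun y i => if hi : i ∈ I then y ⟨i, hi⟩ else (0, 0) with hext
  have hextm : Measurable ext := by
    refine measurable_pi_iff.2 fun i => ?_
    by_cases hi : i ∈ I
    · simp only [hext, hi, dite_true]
      exact measurable_pi_apply _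
    · simp only [hext, hi, dite_false]
      exact measurable_const
  have hφ : Measurable fun q : Matrix (Fin d) (Fin m) ℝ ×
      (I → Fin 2 × EuclideanSpace ℝ (Fin d)) => iterate qr b q.1 (ext q.2) k :=
    (measurable_iterate hqr b k).comp (measurable_fst.prodMk (hextm.comp measurable_snd))
  have hfin := hind.comp hφ measurable_id
  have heq : (fun ω => iterate qr b (G ω) (fun i => s i ω) k) =
      (fun q : Matrix (Fin d) (Fin m) ℝ × (I → Fin 2 × EuclideanSpace ℝ (Fin d)) =>
        iterate qr b q.1 (ext q.2) k) ∘ fun ω => (G ω, fun i : I => s i ω) := by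
    ext1 ω
    refine iterate_congr _ k fun i hi => ?_
    have hi' : i ∈ I := Finset.mem_Iic.2 hi
    simp [hext, hi']
  rw [heq]
  exact hfin

end RandomInput

/-! ### Block-size arithmetic -/

section Numerics

/-- Bernstein's linear condition is the geometric mean of `h1` and `h2`: `V` cancels in their
product. Hence the block size needs no separate term of order `𝓜 / (ε Δ)`. -/
theorem mul_le_mul_of_bernstein {A A' k K V T r l : ℝ} (hV : 0 < V) (hA' : 0 ≤ A')
    (hT : 0 ≤ T) (hr : 0 ≤ r) (hl : 0 ≤ l) (h1 : A * (K ^ 2 / V) * l ≤ T)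
    (h2 : A' * V * l ≤ T * r ^ 2) (hk : k ^ 2 ≤ A * A') : k * K * l ≤ T * r := by
  refine le_of_sq_le_sq ?_ (mul_nonneg hT hr)
  have h3 : (A * (K ^ 2 / V) * l) * (A' * V * l) ≤ T * (T * r ^ 2) :=
    mul_le_mul h1 h2 (by positivity) hT
  have h4 : (A * (K ^ 2 / V) * l) * (A' * V * l) = A * A' * (K * l) ^ 2 := by
    field_simp
  calc (k * K * l) ^ 2 = k ^ 2 * (K * l) ^ 2 := by ring
    _ ≤ A * A' * (K * l) ^ 2 := mul_le_mul_of_nonneg_right hk (sq_nonneg _)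
    _ ≤ (T * r) ^ 2 := by rw [← h4]; linarith [h3]

end Numerics

section Numerics

theorem blockSize_bounds {q T K V Δ ε δ L l : ℝ} (hq : 0 < q) (hV : 0 < V) (hK : 0 < K)
    (hΔ : 0 < Δ) (hε : 0 < ε) (hδ : 0 < δ) (hl : 0 < l) (hlL : l ≤ L)
    (hT : 1000000 * (V / Δ ^ 2 * (q / δ ^ 2 * l + 1 / ε ^ 2 * L) + max 1 (K ^ 2 / V) * L) ≤ T) :
    16 * (5 * L) ≤ T ∧
    2 * (1 * K) * (5 * L) ≤ T * (ε * Δ / 20) ∧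
    4 * (1 ^ 2 * V) * (5 * L) ≤ T * (ε * Δ / 20) ^ 2 ∧
    2 * (4 * K) * (6 * l) ≤ T * (δ * Δ / (40 * Real.sqrt q)) ∧
    4 * (4 ^ 2 * V) * (6 * l) ≤ T * (δ * Δ / (40 * Real.sqrt q)) ^ 2 := by
  have hL : 0 < L := hl.trans_le hlL
  have hx : 0 ≤ V / Δ ^ 2 * (q / δ ^ 2 * l) := by positivity
  have hy : 0 ≤ V / Δ ^ 2 * (1 / ε ^ 2 * L) := by positivity
  have hz : L ≤ max 1 (K ^ 2 / V) * L := by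
    nlinarith [le_max_left 1 (K ^ 2 / V)]
  have hw : K ^ 2 / V * L ≤ max 1 (K ^ 2 / V) * L :=
    mul_le_mul_of_nonneg_right (le_max_right _ _) hL.le
  have hwl : K ^ 2 / V * l ≤ K ^ 2 / V * L := mul_le_mul_of_nonneg_left hlL (by positivity)
  rw [mul_add (V / Δ ^ 2)] at hT
  have hT0 : 0 ≤ T := by linarith
  have hsq : Real.sqrt q ^ 2 = q := Real.sq_sqrt hq.le
  have hsq0 : 0 < Real.sqrt q := Real.sqrt_pos.2 hq
  -- `2500 = 10⁶ / 20²`; likewise `625 = 10⁶ / 40²` in `h4`. The values of `k` below are the square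
  -- roots of `10⁶ * 2500` and `10⁶ * 625`.
  have h2 : 2500 * V * L ≤ T * (ε * Δ / 20) ^ 2 := by
    calc 2500 * V * L =
        1000000 * (V / Δ ^ 2 * (1 / ε ^ 2 * L)) * (ε * Δ / 20) ^ 2 := by field_simp; norm_num
      _ ≤ _ := mul_le_mul_of_nonneg_right (by linarith) (sq_nonneg _)
  have h4 : 625 * V * l ≤ T * (δ * Δ / (40 * Real.sqrt q)) ^ 2 := by
    calc 625 * V * l =
        1000000 * (V / Δ ^ 2 * (q / δ ^ 2 * l)) * (δ * Δ / (40 * Real.sqrt q)) ^ 2 := by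
          rw [div_pow, mul_pow 40, hsq]
          field_simp
          norm_num
      _ ≤ _ := mul_le_mul_of_nonneg_right (by linarith) (sq_nonneg _)
  have h1 := mul_le_mul_of_bernstein (A := 1000000) (A' := 2500) (k := 50000) (K := K) hV
    (by norm_num) hT0 (by positivity) hL.le (by linarith) h2 (by norm_num)
  have h3 := mul_le_mul_of_bernstein (A := 1000000) (A' := 625) (k := 25000) (K := K) hV
    (by norm_num) hT0 (by positivity) hl.le (by linarith) h4 (by norm_num)
  have hKL := mul_pos hK hL
  have hKl := mul_pos hK hl
  have hVL := mul_pos hV hL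
  have hVl := mul_pos hV hl
  refine ⟨by linarith, by nlinarith, by nlinarith, by nlinarith, by nlinarith⟩

end Numerics
end FairPCA

end

/-! ### The main theorem -/

theorem mainTheorem2 :
    ∃ C : ℝ, 0 < C ∧
      ∀ (d m : ℕ), 1 ≤ m → m < d →
      ∀ (𝓜 𝓥 pmin Δ ε δ : ℝ), 0 < 𝓜 → 0 < 𝓥 → pmin ∈ Set.Ioc (0 : ℝ) (1 / 2) → 0 < Δ →
        ε ∈ Set.Ioo (0 : ℝ) 1 → δ ∈ Set.Ioo (0 : ℝ) 1 →
      ∀ (D : Fin 2 → Measure (EuclideanSpace ℝ (Fin d))) (p : ℝ),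
        FairPCA.DataAssumption m D p 𝓜 𝓥 pmin Δ →
      ∀ (P : Matrix (Fin d) (Fin m) ℝ), FairPCA.IsTopEigenvectors (FairPCA.momentGap D) P →
      ∀ (qr : Matrix (Fin d) (Fin m) ℝ → Matrix (Fin d) (Fin m) ℝ), FairPCA.IsQRRoutine qr →
      ∀ (b : ℕ),
        C * (𝓥 / (Δ ^ 2 * pmin) *
              ((d * m : ℝ) / δ ^ 2 * max (Real.log (m / δ)) (Real.log 2) +
                1 / ε ^ 2 * Real.log (d / δ)) +
            max 1 (𝓜 ^ 2 / 𝓥) / pmin * Real.log (d / δ)) ≤ (b : ℝ) →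
      ∀ (Ω : Type*) [MeasurableSpace Ω] (μ : Measure Ω) [IsProbabilityMeasure μ]
        (G : Ω → Matrix (Fin d) (Fin m) ℝ) (s : ℕ → Ω → Fin 2 × EuclideanSpace ℝ (Fin d)),
        FairPCA.IsRandomInput μ D p G s →
      ∀ t : ℕ, 1 ≤ t →
        1 - δ ≤ μ.real {ω |
          5 * ‖FairPCA.noise qr b (FairPCA.momentGap D) (G ω) (fun i => s i ω) t‖ ≤ ε * Δ ∧
          5 * ‖Pᵀ * FairPCA.noise qr b (FairPCA.momentGap D) (G ω) (fun i => s i ω) t‖ ≤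
            δ * Δ / (2 * Real.sqrt (d * m))} := by
  refine ⟨1000000, by norm_num, ?_⟩
  intro d m hm hmd 𝓜 𝓥 pmin Δ ε δ hM hV hpmin hΔ hε hδ D p hD P hP qr hqr b hb Ω _ μ _ G s hin t ht
  have hprob := hD.isProb
  have hp : p ∈ Set.Icc (0 : ℝ) 1 :=
    ⟨hpmin.1.le.trans hD.p_mem.1, by linarith [hD.p_mem.2, hpmin.1]⟩
  have hm1 : (1 : ℝ) ≤ m := by exact_mod_cast hm
  have hmd' : (m : ℝ) ≤ d := by exact_mod_cast hmd.le
  have hd2 : (2 : ℝ) ≤ d := by exact_mod_cast (by omega : 2 ≤ d)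
  have hδ0 := hδ.1
  set L := Real.log (d / δ) with hL
  set l := max (Real.log (m / δ)) (Real.log 2) with hl
  have hl0 : 0 < l := (Real.log_pos one_lt_two).trans_le (le_max_right _ _)
  -- Uses `m ≤ d` for the first logarithm and `2 ≤ d ≤ d / δ` for the second.
  have hlL : l ≤ L := by
    refine max_le (Real.log_le_log (by positivity) (by gcongr)) (Real.log_le_log two_pos ?_)
    rw [le_div_iff₀ hδ0]
    nlinarith [hδ.2]
  have hexpL : Real.exp (-L) = δ / d := by
    rw [Real.exp_neg, hL, Real.exp_log (by positivity), inv_div]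
  have hexpl : Real.exp (-l) ≤ δ / m := by
    calc Real.exp (-l) ≤ Real.exp (-Real.log (m / δ)) :=
          Real.exp_le_exp.2 (neg_le_neg (le_max_left _ _))
      _ = δ / m := by rw [Real.exp_neg, Real.exp_log (by positivity), inv_div]
  have hexpl2 : Real.exp (-l) ≤ 1 / 2 := by
    calc Real.exp (-l) ≤ Real.exp (-Real.log 2) :=
          Real.exp_le_exp.2 (neg_le_neg (le_max_right _ _))
      _ = 1 / 2 := by rw [Real.exp_neg, Real.exp_log two_pos, one_div]
  have hexpL2 : Real.exp (-L) ≤ 1 / 2 :=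
    (Real.exp_le_exp.2 (neg_le_neg hlL)).trans hexpl2
  -- The noise is bounded by `4 r` and `4 r'`, so `r` and `r'` are one twentieth of the two targets.
  set r := ε * Δ / 20 with hr
  set r' := δ * Δ / (40 * Real.sqrt (d * m)) with hr'
  set T : Fin 2 → ℝ := fun a => b * FairPCA.groupProb p a with hTdef
  have hbT (a : Fin 2) : 1000000 * (𝓥 / Δ ^ 2 * ((d * m : ℝ) / δ ^ 2 * l + 1 / ε ^ 2 * L) +
      max 1 (𝓜 ^ 2 / 𝓥) * L) ≤ T a := by
    have hpa : pmin ≤ FairPCA.groupProb p a := by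
      unfold FairPCA.groupProb
      split_ifs <;> linarith [hD.p_mem.1, hD.p_mem.2]
    have hpos := hpmin.1
    refine le_trans (le_trans (le_of_eq ?_) (mul_le_mul_of_nonneg_right hb hpos.le))
      (mul_le_mul_of_nonneg_left hpa (Nat.cast_nonneg b))
    field_simp
  have hnum (a : Fin 2) := FairPCA.blockSize_bounds (q := d * m) (by positivity) hV hM hΔ hε.1 hδ0
    hl0 hlL (hbT a)
  have hT0 (a : Fin 2) : 0 < T a := by linarith [(hnum a).1]
  have htb : t * b - (t - 1) * b = b := by
    rw [← Nat.sub_mul, Nat.sub_sub_self ht, one_mul]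
  set J := Finset.Ioc ((t - 1) * b) (t * b) with hJ
  set W : Ω → Matrix (Fin d) (Fin m) ℝ := fun ω =>
    FairPCA.iterate qr b (G ω) (fun i => s i ω) (t - 1) with hW
  -- Orthonormality is part of the event so that its slices are empty at all other matrices; every
  -- slice then obeys the same bound.
  set B : Set (Matrix (Fin d) (Fin m) ℝ × (J → Fin 2 × EuclideanSpace ℝ (Fin d))) :=
    {q | q.1ᵀ * q.1 = 1 ∧ q.2 ∈ FairPCA.badBlocks D P q.1 T r r'} with hB
  have hBm : MeasurableSet B := FairPCA.measurableSet_badBlocks D P T r r'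
  have hslice (A : Matrix (Fin d) (Fin m) ℝ) :
      (Measure.pi fun _ : J => FairPCA.pairLaw D p) (Prod.mk A ⁻¹' B) ≤ ENNReal.ofReal δ := by
    by_cases hA : Aᵀ * A = 1
    -- One factor `exp (-L) = δ / d` or `exp (-l) ≤ δ / m` cancels the dimension; the remaining four
    -- or five factors, each at most `1 / 2`, bring the constants `2` and `4` down to `1 / 8`. The
    -- bound `exp (-l) ≤ 1 / 2` is where the maximum with `log 2` enters.
    · refine (measure_mono fun y hy => hy.2).trans (FairPCA.measure_badBlocks_le (κ := 5 * L)
        (κ' := 6 * l) (by omega) (by omega) hp hP.1 hA hD.bounded hD.variance_le hM hV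
        (by positivity [hε.1]) (by positivity) T (fun a => ?_) (fun a => (hnum a).1)
        (fun a => (hnum a).2.1) (fun a => (hnum a).2.2.1) (fun a => (hnum a).2.2.2.1)
        (fun a => (hnum a).2.2.2.2) ?_ ?_)
      · rw [Fintype.card_coe, hJ, Nat.card_Ioc, htb]
      · have h5 : Real.exp (-(5 * L)) = δ / d * Real.exp (-L) ^ 4 := by
          rw [← hexpL, ← pow_succ', ← Real.exp_nat_mul]
          congr 1
          push_cast
          ring
        have h6 : Real.exp (-L) ^ 4 ≤ (1 / 2) ^ 4 :=
          pow_le_pow_left₀ (Real.exp_pos _).le hexpL2 4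
        calc 2 * d * Real.exp (-(5 * L)) = 2 * δ * Real.exp (-L) ^ 4 := by
              rw [h5]
              field_simp
          _ ≤ 2 * δ * (1 / 2) ^ 4 := by gcongr
          _ = δ / 8 := by ring
      · have h5 : Real.exp (-(6 * l)) = Real.exp (-l) * Real.exp (-l) ^ 5 := by
          rw [← pow_succ', ← Real.exp_nat_mul]
          congr 1
          push_cast
          ring
        have h6 : Real.exp (-l) ^ 5 ≤ (1 / 2) ^ 5 :=
          pow_le_pow_left₀ (Real.exp_pos _).le hexpl2 5
        calc 2 * (m + m : ℕ) * Real.exp (-(6 * l)) ≤ 2 * (m + m : ℕ) * (δ / m * (1 / 2) ^ 5) := by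
              rw [h5]
              gcongr
          _ = δ / 8 := by
              push_cast
              field_simp
              norm_num
    · have : Prod.mk A ⁻¹' B = ∅ := by
        ext y
        simp [hB, hA]
      rw [this, measure_empty]
      exact zero_le
  have hWm : AEMeasurable W μ := hin.aemeasurable_iterate hqr b (t - 1)
  have hYm : AEMeasurable (fun ω (i : J) => s i ω) μ :=
    aemeasurable_pi_lambda _ fun i => (hin.sample_law i).aemeasurable
  have hbad : μ {ω | (W ω, fun i : J => s i ω) ∈ B} ≤ ENNReal.ofReal δ := by
    have hWprob := Measure.isProbabilityMeasure_map hWm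
    have hpair := FairPCA.isProbabilityMeasure_pairLaw (D := D) hp
    -- By independence the joint law of iterate and block is a product, so the slice bound
    -- integrates to a bound for the random iterate.
    have hlaw := (hin.indepFun_iterate_block hqr b (t - 1) (t * b)).map_prod_eq_prod_map_map
      hWm hYm
    rw [hin.map_block] at hlaw
    have h := Measure.map_apply_of_aemeasurable (hWm.prodMk hYm) hBm
    rw [hlaw, Measure.prod_apply hBm] at h
    refine h.symm.le.trans ((lintegral_mono hslice).trans ?_)
    rw [lintegral_const, measure_univ, mul_one]
  have hgood : {ω | (W ω, fun i : J => s i ω) ∈ B}ᶜ ⊆ {ω |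
      5 * ‖FairPCA.noise qr b (FairPCA.momentGap D) (G ω) (fun i => s i ω) t‖ ≤ ε * Δ ∧
      5 * ‖Pᵀ * FairPCA.noise qr b (FairPCA.momentGap D) (G ω) (fun i => s i ω) t‖ ≤
        δ * Δ / (2 * Real.sqrt (d * m))} := by
    intro ω hω
    have hortho := FairPCA.iterate_transpose_mul_self hqr b (G ω) (fun i => s i ω) (t - 1)
    have hnot : (fun i : J => s i ω) ∉ FairPCA.badBlocks D P (W ω) T r r' := fun h =>
      hω ⟨hortho, h⟩
    simp only [FairPCA.badBlocks, Set.mem_iUnion, Set.mem_union, Set.mem_ofPred_eq, not_exists,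
      not_or, not_le] at hnot
    have hsum1 (a : Fin 2) : ∑ i : J, FairPCA.groupInd a (s i ω) =
        ∑ i ∈ J, FairPCA.groupInd a (s i ω) :=
      Finset.sum_coe_sort J fun i => FairPCA.groupInd a (s i ω)
    have hsum2 (a : Fin 2) : ∑ i : J, FairPCA.groupDev D a (s i ω) =
        ∑ i ∈ J, FairPCA.groupDev D a (s i ω) :=
      Finset.sum_coe_sort J fun i => FairPCA.groupDev D a (s i ω)
    simp only [hsum1, hsum2] at hnot
    obtain ⟨h1, h2⟩ := FairPCA.norm_noise_le D P hT0
      (FairPCA.norm_le_one_of_transpose_mul_self hortho) (fun a => (hnot a).1)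
      (fun a => (hnot a).2.1.le)
      (fun a => (FairPCA.norm_transpose_mul_mul_le P _ _).trans (hnot a).2.2.le)
    refine ⟨?_, ?_⟩
    · rw [hr] at h1
      linarith
    · have : δ * Δ / (2 * Real.sqrt (d * m)) = 20 * r' := by
        have : 0 < Real.sqrt ((d : ℝ) * m) := Real.sqrt_pos.2 (by positivity)
        rw [hr']
        field_simp
        norm_num
      rw [this]
      linarith
  have hbad' : μ.real {ω | (W ω, fun i : J => s i ω) ∈ B} ≤ δ :=
    ENNReal.toReal_le_of_le_ofReal hδ0.le hbad
  have huniv : (1 : ℝ) ≤ μ.real {ω | (W ω, fun i : J => s i ω) ∈ B} +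
      μ.real {ω | (W ω, fun i : J => s i ω) ∈ B}ᶜ := by
    rw [← probReal_univ (μ := μ), ← Set.union_compl_self {ω | (W ω, fun i : J => s i ω) ∈ B}]
    exact measureReal_union_le _ _
  linarith [measureReal_mono (μ := μ) hgood]
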